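/- Let $H$ be a finite hypergraph with non-empty vertex set $V(H)$ and edge set $E(H)\subseteq 2^{V(H)}$. Assume that every edge has at most 3 vertices (rank 3), that any two distinct edges share at most one vertex ($H$ is linear), and that $H$ is reduced: no edge of size exactly 3 is a leaf-edge, where a leaf-edge is an edge with at most one vertex of degree greater than 1 (the degree of a vertex is the number of edges containing it). In the Avoider-Enforcer game on $H$, two players, Avoider and Enforcer, alternately pick a not yet picked vertex of $H$ until all vertices are picked. Enforcer wins if Avoider has picked all the vertices of some edge (in particular whenever $\varnothing\in E(H)$); otherwise Avoider wins. Avoider wins on $H$ as last player if she has a winning strategy when she plays the last move, i.e. when she is the first player if $|V(H)|$ is odd and the second player if $|V(H)|$ is even. A hypergraph $K$ is a subhypergraph of $H$ if $V(K)\subseteq V(H)$ and $E(K)\subseteq E(H)$. A hypergraph is connected if for any two distinct vertices $a,b$ there are edges $e_1,\dots,e_\ell$ ($\ell\ge 1$) with $a\in e_1$, $b\in e_\ell$ and $e_i\cap e_{i+1}\neq\varnothing$ for all $i<\ell$; the connected components of $H$ are its maximal connected subhypergraphs. For distinct vertices $a,b$, an $ab$-chain of length $\ell\ge 1$ is a linear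 hypergraph consisting of $\ell$ pairwise distinct edges $e_1,\dots,e_\ell$ of size 3 and their vertices, such that $e_i\cap e_{i+1}\ne\varnothing$ for all $i<\ell$, $e_i\cap e_j=\varnothing$ whenever $|i-j|\ge 2$, $e_1$ is the only edge containing $a$, and $e_\ell$ is the only edge containing $b$. A cycle of length $\ell\ge 3$ is a hypergraph obtained from an $ab$-chain of length $\ell-1$ by adding a new vertex $c$ and the edge $\{a,b,c\}$. A prism is a hypergraph obtained from a cycle of length 3 by adding the edge formed by its three vertices of degree 1. An isolated 2-edge is a hypergraph with exactly two vertices and with exactly one edge, which contains both; an isolated vertex is a hypergraph with exactly one vertex and no edge. Then Avoider wins on $H$ as last player if and only if each connected component of $H$ is a cycle, a prism, an isolated 2-edge or an isolated vertex. -/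

import Mathlib

namespace Hypergraph

/-- The degree of `v`: the number of edges containing it. -/
noncomputable def degree {α : Type*} (H : Hypergraph α) (v : α) : ℕ∞ :=
  {e | e ∈ E(H) ∧ v ∈ e}.encard

/-- `H` has rank `k`: all its edges have at most `k` vertices. -/
def HasRank {α : Type*} (H : Hypergraph α) (k : ℕ) : Prop :=
  ∀ e ∈ E(H), e.encard ≤ (k : ℕ∞)

/-- `H` is linear: any two distinct edges share at most one vertex. -/
def IsLinear {α : Type*} (H : Hypergraph α) : Prop :=
  ∀ e ∈ E(H), ∀ f ∈ E(H), e ≠ f → (e ∩ f).Subsingleton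

/-- A leaf-edge is an edge with at most one vertex of degree greater than 1. -/
def IsLeafEdge {α : Type*} (H : Hypergraph α) (e : Set α) : Prop :=
  e ∈ E(H) ∧ {v | v ∈ e ∧ 1 < H.degree v}.Subsingleton

/-- A hypergraph (of rank 3) is reduced if it contains no leaf-edge of size 3. -/
def IsReduced {α : Type*} (H : Hypergraph α) : Prop :=
  ∀ e, H.IsLeafEdge e → e.encard ≠ 3

/-! ### Walks, connectedness, components -/

/-- `K` is a subhypergraph of `H`. -/
def IsSubhypergraph {α : Type*} (K H : Hypergraph α) : Prop :=
  V(K) ⊆ V(H) ∧ E(K) ⊆ E(H)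

/-- `(e 0, …, e n)` is a walk in `H`: a sequence of edges, consecutive ones intersecting. -/
def IsWalk {α : Type*} (H : Hypergraph α) {n : ℕ} (e : Fin (n + 1) → Set α) : Prop :=
  (∀ i, e i ∈ E(H)) ∧ ∀ i : Fin n, (e i.castSucc ∩ e i.succ).Nonempty

/-- Any two distinct vertices are joined by a walk. -/
def IsConnected {α : Type*} (H : Hypergraph α) : Prop :=
  ∀ a ∈ V(H), ∀ b ∈ V(H), a ≠ b →
    ∃ (n : ℕ) (e : Fin (n + 1) → Set α), H.IsWalk e ∧ a ∈ e 0 ∧ b ∈ e (Fin.last n)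

/-- `K` is a connected component of `H`: a maximal connected subhypergraph. -/
def IsComponent {α : Type*} (K H : Hypergraph α) : Prop :=
  K.IsSubhypergraph H ∧ K.IsConnected ∧
    ∀ K' : Hypergraph α, K'.IsSubhypergraph H → K'.IsConnected →
      K.IsSubhypergraph K' → K' = K

/-! ### Isolated vertices and 2-edges, chains, cycles, the prism -/

/-- The hypergraph consisting of one vertex and no edge. -/
def IsIsolatedVertex {α : Type*} (H : Hypergraph α) : Prop :=
  ∃ v, V(H) = {v} ∧ E(H) = ∅

/-- The hypergraph consisting of two vertices and one edge containing both. -/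
def IsIsolatedTwoEdge {α : Type*} (H : Hypergraph α) : Prop :=
  ∃ a b, a ≠ b ∧ V(H) = {a, b} ∧ E(H) = {{a, b}}

/-- `P` is an `ab`-chain of length `n + 1`: it consists of the pairwise distinct edges
`e 0, …, e n`, which form a linear simple walk, all of size 3, and `e 0` (resp. `e n`) is the only
edge containing `a` (resp. `b`). -/
structure IsChain {α : Type*} (P : Hypergraph α) (a b : α) {n : ℕ}
    (e : Fin (n + 1) → Set α) : Prop where
  ne : a ≠ b
  vertexSet_eq : V(P) = ⋃ i, e i
  edgeSet_eq : E(P) = Set.range e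
  injective : Function.Injective e
  walk : P.IsWalk e
  simple : ∀ i j : Fin (n + 1), (i : ℕ) + 2 ≤ (j : ℕ) → Disjoint (e i) (e j)
  linear : P.IsLinear
  size : ∀ i, (e i).encard = 3
  left : ∀ i, a ∈ e i ↔ i = 0
  right : ∀ i, b ∈ e i ↔ i = Fin.last n

/-- `C` is a cycle of length `l` (necessarily `l ≥ 3`): it is obtained from an `ab`-chain of length
`l - 1 ≥ 2` by adding a 3-edge `{a, b, c}` where `c` is a new vertex. -/
def IsCycleOfLength {α : Type*} (C : Hypergraph α) (l : ℕ) : Prop :=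
  ∃ (P : Hypergraph α) (a b c : α) (n : ℕ) (e : Fin (n + 1) → Set α),
    P.IsChain a b e ∧ 2 ≤ n + 1 ∧ l = n + 2 ∧ c ∉ V(P) ∧
      V(C) = insert c V(P) ∧ E(C) = insert {a, b, c} E(P)

/-- `C` is a cycle. -/
def IsCycle {α : Type*} (C : Hypergraph α) : Prop :=
  ∃ l, C.IsCycleOfLength l

/-- `H` is a prism: it is obtained from a cycle of length 3 by adding the edge formed by the
(three) vertices of degree 1 of that cycle. -/
def IsPrism {α : Type*} (H : Hypergraph α) : Prop :=
  ∃ C : Hypergraph α, C.IsCycleOfLength 3 ∧ V(H) = V(C) ∧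
    E(H) = insert {v | v ∈ V(C) ∧ C.degree v = 1} E(C)

/-! ### The Avoider-Enforcer game -/

/-- The two players. -/
inductive Player : Type
  | avoider
  | enforcer

/-- `H.AvoiderWinsFrom p A B`: Avoider has a winning strategy from the position where Avoider has
picked the vertices in `A`, Enforcer has picked the vertices in `B`, and it is the turn of `p`.
The players alternately pick an unpicked vertex until all vertices are picked, and Avoider wins
if and only if she has not picked all the vertices of some edge. -/
inductive AvoiderWinsFrom {α : Type*} (H : Hypergraph α) : Player → Set α → Set α → Prop
  | gameOver (p : Player) (A B : Set α) (hover : V(H) ⊆ A ∪ B) (hwin : ∀ e ∈ E(H), ¬ e ⊆ A) :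
      AvoiderWinsFrom H p A B
  | avoiderMove (A B : Set α) (x : α) (hx : x ∈ V(H) \ (A ∪ B))
      (h : AvoiderWinsFrom H Player.enforcer (insert x A) B) :
      AvoiderWinsFrom H Player.avoider A B
  | enforcerMove (A B : Set α) (hne : (V(H) \ (A ∪ B)).Nonempty)
      (h : ∀ y ∈ V(H) \ (A ∪ B), AvoiderWinsFrom H Player.avoider A (insert y B)) :
      AvoiderWinsFrom H Player.enforcer A B

/-- Avoider wins on `H` as first player. -/
def AvoiderWinsAsFirst {α : Type*} (H : Hypergraph α) : Prop :=
  H.AvoiderWinsFrom Player.avoider ∅ ∅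

/-- Avoider wins on `H` as second player. -/
def AvoiderWinsAsSecond {α : Type*} (H : Hypergraph α) : Prop :=
  H.AvoiderWinsFrom Player.enforcer ∅ ∅

/-- Avoider wins on the finite hypergraph `H` as last player, i.e. as the player who plays the last
move: this is the first player if the number of vertices is odd, the second one if it is even. -/
def AvoiderWinsAsLast {α : Type*} (H : Hypergraph α) : Prop :=
  (Odd V(H).ncard ∧ H.AvoiderWinsAsFirst) ∨ (Even V(H).ncard ∧ H.AvoiderWinsAsSecond)

end Hypergraph

/-! ### The finite game: monotonicity, disjoint unions, pairing strategies. -/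

namespace AvoiderEnforcer

open Finset

variable {α : Type*} [DecidableEq α]

/-! Releasing a vertex of Avoider, or handing a free vertex to Enforcer, never hurts Avoider as last
player (`Wins.weaken`). So a win on `H` passes to every vertex subset with the edges inside it, and
subfamilies with an odd number of vertices give strong constraints.

Suppose Avoider wins on a connected family with an odd number of vertices, starting with `x`. Grow a
tree of 3-edges from `x`, each new edge meeting the current vertices exactly once. Owning the root
and a second vertex of such a tree loses (`Grow.not_wins_pair`). Hence once Enforcer owns everything
outside the tree except a free vertex `v`, Avoider must pick `v` (`Grow.wins_insert`). Such forced
moves make her lose as soon as an edge closes up on the tree or a 2-edge touches it. So the family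
is itself a tree, with one more vertex than twice its number of edges (`card_vertices_of_odd`).

Now take a connected subfamily with exactly twice as many vertices as edges. An edge adding one
vertex to it would give an odd family with one edge too many. Edges adding two vertices keep the
balance, but at the end of a maximal growth the last one would be a leaf-edge, against reducedness.
So no edge leaves the subfamily (`subset_of_inter_nonempty`). A 2-edge is balanced in this sense,
and so is a cycle; if all edges have size 3 and there is at least one, a cycle exists
(`exists_cycleSeq`). Either one therefore fills its component. Any further edge on a cycle contains
all its vertices of degree 1 (`IsCycleSeq.midpoint_mem`), which leaves only the prism.

Conversely, on a cycle or a prism the edges that survive Enforcer's first move can be eliminated one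
by one, each having two private vertices, and Avoider wins by pairing (`wins_of_private_pairs`).
Strategies on the components combine by `Wins.union`. -/

/-- `WinsIn E n A R`: Avoider, having picked `A`, wins as last player on the edges `E` when `R` is
the set of free vertices and `n` moves remain (so that it is Avoider's turn iff `n` is odd). -/
def WinsIn (E : Finset (Finset α)) : ℕ → Finset α → Finset α → Prop
  | 0, A, _ => ∀ e ∈ E, ¬ e ⊆ A
  | n + 1, A, R =>
    if Even (n + 1) then ∀ y ∈ R, WinsIn E n A (R.erase y)
    else ∃ x ∈ R, WinsIn E n (insert x A) (R.erase x)

/-- Avoider, having picked `A`, wins as last player when `R` is the set of free vertices. -/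
def Wins (E : Finset (Finset α)) (A R : Finset α) : Prop := WinsIn E R.card A R

variable {E E' : Finset (Finset α)} {A A' R R' : Finset α} {x y : α}

theorem wins_empty : Wins E A ∅ ↔ ∀ e ∈ E, ¬ e ⊆ A := by
  simp [Wins, WinsIn]

theorem wins_of_odd (h : Odd R.card) :
    Wins E A R ↔ ∃ x ∈ R, Wins E (insert x A) (R.erase x) := by
  unfold Wins
  obtain ⟨n, hn⟩ : ∃ n, R.card = n + 1 := ⟨R.card - 1, by have := h.pos; omega⟩
  rw [hn] at h ⊢
  rw [WinsIn, if_neg (Nat.not_even_iff_odd.2 h)]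
  refine exists_congr fun x => and_congr_right fun hx => ?_
  rw [card_erase_of_mem hx, hn, Nat.add_sub_cancel]

theorem wins_of_even (h : Even R.card) (hR : R.Nonempty) :
    Wins E A R ↔ ∀ y ∈ R, Wins E A (R.erase y) := by
  unfold Wins
  obtain ⟨n, hn⟩ : ∃ n, R.card = n + 1 := ⟨R.card - 1, by have := hR.card_pos; omega⟩
  rw [hn] at h ⊢
  rw [WinsIn, if_pos h]
  refine forall₂_congr fun x hx => ?_
  rw [card_erase_of_mem hx, hn, Nat.add_sub_cancel]

theorem odd_card_erase (h : Even R.card) (hx : x ∈ R) : Odd (R.erase x).card := by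
  rw [← card_erase_add_one hx] at h
  grind

theorem even_card_erase (h : Odd R.card) (hx : x ∈ R) : Even (R.erase x).card := by
  rw [← card_erase_add_one hx] at h
  grind

theorem wins_empty_edges (A R : Finset α) : Wins ∅ A R := by
  induction hn : R.card generalizing A R with
  | zero => rw [card_eq_zero] at hn; subst hn; simp [wins_empty]
  | succ n ih =>
    have hne : R.Nonempty := card_pos.1 (by omega)
    rcases Nat.even_or_odd R.card with h | h
    · rw [wins_of_even h hne]
      exact fun y hy => ih _ _ (by rw [card_erase_of_mem hy]; omega)
    · rw [wins_of_odd h]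
      obtain ⟨x, hx⟩ := hne
      exact ⟨x, hx, ih _ _ (by rw [card_erase_of_mem hx]; omega)⟩

/-- Avoider keeps her moves. Only edges she can still complete, those inside `A' ∪ R`, have to be
dominated by an edge of `E`. -/
theorem Wins.mono (h : Wins E A R) (hA : A' ⊆ A)
    (hE : ∀ f ∈ E', f ⊆ A' ∪ R → ∃ e ∈ E, e ⊆ f) : Wins E' A' R := by
  induction hn : R.card generalizing A A' R with
  | zero =>
    rw [card_eq_zero] at hn; subst hn
    rw [wins_empty] at h ⊢
    intro f hf hfA
    obtain ⟨e, he, hef⟩ := hE f hf (by simpa using hfA)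
    exact h e he (hef.trans (hfA.trans hA))
  | succ n ih =>
    have hne : R.Nonempty := card_pos.1 (by omega)
    rcases Nat.even_or_odd R.card with hp | hp
    · rw [wins_of_even hp hne] at h ⊢
      refine fun y hy => ih (h y hy) hA (fun f hf hfA => hE f hf (hfA.trans ?_))
        (by rw [card_erase_of_mem hy]; omega)
      exact union_subset_union_right (erase_subset _ _)
    · rw [wins_of_odd hp] at h ⊢
      obtain ⟨x, hx, h⟩ := h
      refine ⟨x, hx, ih h (insert_subset_insert _ hA) (fun f hf hfA => hE f hf (hfA.trans ?_))
        (by rw [card_erase_of_mem hx]; omega)⟩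
      intro z
      grind

/-- If Avoider is to move in the new position, she picks `x`. Otherwise Enforcer picks some `z`;
Avoider answers with `x`, or with her planned move `t` if `z = x`, and the induction repairs the
change of order. -/
theorem Wins.of_insert (h : Wins E (insert x A) R) : Wins E A (insert x R) := by
  by_cases hx : x ∈ R
  · rw [insert_eq_of_mem hx]
    exact h.mono (subset_insert _ _) fun f hf _ => ⟨f, hf, Subset.rfl⟩
  rcases Nat.even_or_odd R.card with hp | hp
  · rw [wins_of_odd (by rw [card_insert_of_notMem hx]; exact hp.add_one)]
    exact ⟨x, mem_insert_self _ _, by rwa [erase_insert hx]⟩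
  induction hn : R.card using Nat.strong_induction_on generalizing A R x with
  | _ n ih =>
    have hne : R.Nonempty := card_pos.1 hp.pos
    rw [wins_of_even (by rw [card_insert_of_notMem hx]; exact hp.add_one) (insert_nonempty _ _)]
    intro z hz
    obtain ⟨t, ht, h'⟩ := (wins_of_odd hp).1 h
    have hxt : x ≠ t := fun h => hx (h ▸ ht)
    have hsub : insert t A ⊆ insert t (insert x A) := insert_subset_insert _ (subset_insert _ _)
    rcases eq_or_ne z x with rfl | hzx
    · rw [erase_insert hx, wins_of_odd hp]
      exact ⟨t, ht, h'.mono hsub fun f hf _ => ⟨f, hf, Subset.rfl⟩⟩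
    have hzR : z ∈ R := by simpa [hzx] using hz
    have hodd : Odd ((insert x R).erase z).card :=
      odd_card_erase (by rw [card_insert_of_notMem hx]; exact hp.add_one) hz
    rw [wins_of_odd hodd]
    refine ⟨x, by simp [hzx.symm], ?_⟩
    have he : ((insert x R).erase z).erase x = R.erase z := by
      ext w; simp only [mem_erase, mem_insert]; grind
    rw [he]
    rcases eq_or_ne z t with rfl | hzt
    · exact h'.mono (subset_insert _ _) fun f hf _ => ⟨f, hf, Subset.rfl⟩
    -- In the winning line Avoider plays `t` and Enforcer then `z`; releasing `t` by induction
    -- leaves her with `x` as only new vertex.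
    have hz' : z ∈ R.erase t := by simp [hzt, hzR]
    have h'' := (wins_of_even (even_card_erase hp ht) ⟨z, hz'⟩).1 h' z hz'
    have hodd' := odd_card_erase (even_card_erase hp ht) hz'
    have h3 := ih _ (by
      rw [card_erase_of_mem hz', card_erase_of_mem ht]
      have := hp.pos
      omega) h'' (by simp) hodd' rfl
    have he' : insert t ((R.erase t).erase z) = R.erase z := by
      ext w; simp only [mem_erase, mem_insert]; grind
    rwa [he'] at h3

/-- If Avoider is to move, let her make the winning move `x`, let Enforcer answer `y`, and release
`x` again. -/
theorem Wins.erase (h : Wins E A R) (hy : y ∈ R) : Wins E A (R.erase y) := by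
  rcases Nat.even_or_odd R.card with hp | hp
  · exact (wins_of_even hp ⟨y, hy⟩).1 h y hy
  obtain ⟨x, hx, h'⟩ := (wins_of_odd hp).1 h
  rcases eq_or_ne y x with rfl | hyx
  · exact h'.mono (subset_insert _ _) fun f hf _ => ⟨f, hf, Subset.rfl⟩
  have hy' : y ∈ R.erase x := by simp [hyx, hy]
  have h'' := ((wins_of_even (even_card_erase hp hx) ⟨y, hy'⟩).1 h' y hy').of_insert
  convert h'' using 1
  ext w; simp only [mem_erase, mem_insert]; grind

theorem Wins.subset (h : Wins E A R) (hR : R' ⊆ R) : Wins E A R' := by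
  induction hn : (R \ R').card generalizing R with
  | zero =>
    rw [card_eq_zero, sdiff_eq_empty_iff_subset] at hn
    rwa [hR.antisymm hn]
  | succ n ih =>
    obtain ⟨y, hy⟩ : (R \ R').Nonempty := card_pos.1 (by omega)
    obtain ⟨hyR, hyR'⟩ := mem_sdiff.1 hy
    refine ih (h.erase hyR) (subset_erase.2 ⟨hR, hyR'⟩) ?_
    rw [erase_sdiff_comm, card_erase_of_mem hy, hn, Nat.add_sub_cancel]

/-- Picked vertices of Avoider may be released, and free vertices may be given to Enforcer. -/
theorem Wins.weaken (h : Wins E A R) (hA : A' ⊆ A) (hR : R' ⊆ R ∪ A) : Wins E A' R' := by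
  have key : ∀ S ⊆ A, Wins E A (R ∪ S) := by
    intro S
    induction S using Finset.induction_on with
    | empty => intro _; simpa using h
    | insert s S _ ih =>
      intro hS
      have hs : s ∈ A := hS (mem_insert_self _ _)
      have := ih ((subset_insert _ _).trans hS)
      rw [← insert_eq_of_mem hs] at this
      simpa [union_insert] using this.of_insert
  exact ((key A Subset.rfl).subset hR).mono hA fun f hf _ => ⟨f, hf, Subset.rfl⟩

theorem Wins.edges (h : Wins E A R) (hE : E' ⊆ E) : Wins E' A R :=
  h.mono Subset.rfl fun f hf _ => ⟨f, hE hf, Subset.rfl⟩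

/-- Give all free vertices outside `e` to Enforcer: a single vertex left over must be picked by
Avoider, who plays last. -/
theorem not_wins_of_card_sdiff_le_one {e : Finset α} (he : e ∈ E) (heAR : e ⊆ A ∪ R)
    (hc : (e \ A).card ≤ 1) : ¬ Wins E A R := by
  intro h
  have h' : Wins E A (e \ A) := h.subset fun z hz => by grind
  rcases Nat.le_one_iff_eq_zero_or_eq_one.1 hc with h0 | h1
  · rw [card_eq_zero] at h0
    rw [h0, wins_empty] at h'
    exact h' e he (sdiff_eq_empty_iff_subset.1 h0)
  · obtain ⟨w, hw⟩ := card_eq_one.1 h1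
    rw [hw, wins_of_odd (by simp)] at h'
    obtain ⟨x, hx, h'⟩ := h'
    rw [mem_singleton] at hx
    subst hx
    rw [erase_singleton, wins_empty] at h'
    refine h' e he fun z hz => ?_
    by_cases hzA : z ∈ A
    · exact mem_insert_of_mem hzA
    · have : z ∈ e \ A := by simp [hz, hzA]
      rw [hw] at this
      exact mem_insert.2 (Or.inl (mem_singleton.1 this))

/-- If Avoider wins as last player on two vertex-disjoint games, then she wins on their union. -/
theorem Wins.union {A₁ A₂ R₁ R₂ : Finset α} (S : Set α) (h₁ : Wins E A₁ R₁) (h₂ : Wins E A₂ R₂)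
    (hS₁ : ∀ z ∈ A₁ ∪ R₁, z ∈ S) (hS₂ : ∀ z ∈ A₂ ∪ R₂, z ∉ S)
    (hE : ∀ e ∈ E, (∀ z ∈ e, z ∈ S) ∨ ∀ z ∈ e, z ∉ S) : Wins E (A₁ ∪ A₂) (R₁ ∪ R₂) := by
  have hdisj : ∀ z ∈ R₁, z ∉ R₂ := fun z h1 h2 =>
    hS₂ z (mem_union_right _ h2) (hS₁ z (mem_union_right _ h1))
  induction hn : (R₁ ∪ R₂).card generalizing A₁ A₂ R₁ R₂ with
  | zero =>
    rw [card_eq_zero, union_eq_empty] at hn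
    obtain ⟨rfl, rfl⟩ := hn
    rw [wins_empty] at h₁ h₂
    rw [empty_union, wins_empty]
    intro e he heA
    rcases hE e he with h | h
    · refine h₁ e he fun z hz => ?_
      rcases mem_union.1 (heA hz) with h' | h'
      · exact h'
      · exact absurd (h z hz) (hS₂ z (mem_union_left _ h'))
    · refine h₂ e he fun z hz => ?_
      rcases mem_union.1 (heA hz) with h' | h'
      · exact absurd (hS₁ z (mem_union_left _ h')) (h z hz)
      · exact h'
  | succ n ih =>
    have hne : (R₁ ∪ R₂).Nonempty := card_pos.1 (by omega)
    have e₁ : ∀ y ∈ R₁, (R₁ ∪ R₂).erase y = R₁.erase y ∪ R₂ := fun y hy => by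
      have := hdisj y hy
      ext w; simp only [mem_erase, mem_union]; grind
    have e₂ : ∀ y ∈ R₂, (R₁ ∪ R₂).erase y = R₁ ∪ R₂.erase y := fun y hy => by
      have : y ∉ R₁ := fun h => hdisj y h hy
      ext w; simp only [mem_erase, mem_union]; grind
    have hc : ∀ y ∈ R₁ ∪ R₂, ((R₁ ∪ R₂).erase y).card = n := fun y hy => by
      rw [card_erase_of_mem hy, hn, Nat.add_sub_cancel]
    rcases Nat.even_or_odd (R₁ ∪ R₂).card with hp | hp
    · rw [wins_of_even hp hne]
      intro y hy
      have hcy := hc y hy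
      rcases mem_union.1 hy with hy | hy
      · rw [e₁ y hy] at hcy ⊢
        refine ih (h₁.erase hy) h₂ ?_ hS₂ ?_ hcy
        · intro z hz; exact hS₁ z (by grind)
        · intro z hz; exact hdisj z (by grind)
      · rw [e₂ y hy] at hcy ⊢
        refine ih h₁ (h₂.erase hy) hS₁ ?_ ?_ hcy
        · intro z hz; exact hS₂ z (by grind)
        · intro z hz; have := hdisj z hz; grind
    · rw [wins_of_odd hp]
      -- On her turn the total is odd, hence so is one of the two parts; it is her turn there, and
      -- she follows that strategy.
      have hodd : Odd R₁.card ∨ Odd R₂.card := by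
        rw [card_union_of_disjoint (disjoint_left.2 hdisj)] at hp
        grind
      rcases hodd with hp' | hp'
      · obtain ⟨x, hx, h⟩ := (wins_of_odd hp').1 h₁
        have hcx := hc x (mem_union_left _ hx)
        refine ⟨x, mem_union_left _ hx, ?_⟩
        rw [e₁ x hx] at hcx ⊢
        rw [← insert_union]
        refine ih h h₂ ?_ hS₂ ?_ hcx
        · intro z hz; exact hS₁ z (by grind)
        · intro z hz; exact hdisj z (by grind)
      · obtain ⟨x, hx, h⟩ := (wins_of_odd hp').1 h₂
        have hcx := hc x (mem_union_right _ hx)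
        refine ⟨x, mem_union_right _ hx, ?_⟩
        rw [e₂ x hx] at hcx ⊢
        rw [← union_insert]
        refine ih h₁ h hS₁ ?_ ?_ hcx
        · intro z hz; exact hS₂ z (by grind)
        · intro z hz; have := hdisj z hz; grind

/-- Avoider wins whenever the edges can be eliminated one by one, each having at the time two
vertices which belong to no other remaining edge. -/
theorem wins_of_private_pairs
    (hE : ∀ F ⊆ E, F.Nonempty → ∃ e ∈ F, ∃ u ∈ e, ∃ v ∈ e, u ≠ v ∧
      ∀ f ∈ F, f ≠ e → u ∉ f ∧ v ∉ f) (R : Finset α) : Wins E ∅ R := by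
  induction hn : E.card generalizing E R with
  | zero =>
    rw [card_eq_zero] at hn; subst hn
    exact wins_empty_edges _ _
  | succ n ih =>
    obtain ⟨e, he, u, hu, v, hv, huv, hpriv⟩ := hE E Subset.rfl (card_pos.1 (by omega))
    have hempty : ∅ ∉ E := by
      intro h0
      obtain ⟨e, he, u, hu, -⟩ := hE {∅} (by simpa using h0) (by simp)
      rw [mem_singleton] at he
      simp [he] at hu
    have ih' := fun R => ih (E := E.erase e) (fun F hF => hE F (hF.trans (erase_subset _ _))) R
      (by rw [card_erase_of_mem he, hn, Nat.add_sub_cancel])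
    -- Replacing `e` by the smaller edge `P` splits the game: as second player on `P` Avoider gets
    -- only one of `u`, `v`, and no other edge meets `P`.
    set P : Finset α := {u, v} with hP
    have hPe : P ⊆ e := by simp [hP, insert_subset_iff, hu, hv]
    have h₁ : Wins (insert P (E.erase e)) ∅ (R \ P) := by
      refine (ih' (R \ P)).mono Subset.rfl fun f hf hfR => ?_
      rcases mem_insert.1 hf with rfl | hf
      · exact absurd (hfR (mem_insert_self u _)) (by simp [hP])
      · exact ⟨f, hf, Subset.rfl⟩
    have h₂ : Wins (insert P (E.erase e)) ∅ P := by
      have hone : ∀ w ∈ P, Wins (insert P (E.erase e)) ∅ {w} := by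
        intro w hw
        rw [wins_of_odd (by simp)]
        refine ⟨w, by simp, ?_⟩
        rw [erase_singleton, wins_empty]
        intro f hf hfw
        rcases mem_insert.1 hf with rfl | hf
        · have := card_le_card hfw
          rw [hP, card_pair huv] at this
          simp at this
        · rw [mem_erase] at hf
          have hw' : w ∉ f := by
            have := hpriv f hf.2 hf.1
            rcases mem_insert.1 hw with rfl | h
            · exact this.1
            · rw [mem_singleton.1 h]; exact this.2
          rcases f.eq_empty_or_nonempty with rfl | ⟨z, hz⟩
          · exact hempty hf.2
          · have : z = w := by simpa using hfw hz
            exact hw' (this ▸ hz)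
      rw [wins_of_even (by rw [hP, card_pair huv]; decide) ⟨u, by simp [hP]⟩]
      intro y hy
      rcases mem_insert.1 hy with rfl | h
      · rw [hP, erase_insert (by simpa using huv)]
        exact hone v (by simp [hP])
      · have hPv : P.erase v = {u} := by
          rw [hP, pair_comm, erase_insert (by simpa using huv.symm)]
        rw [mem_singleton.1 h, hPv]
        exact hone u (by simp [hP])
    have h₃ := h₁.union {z | z ∉ P} h₂ (by simp) (by simp) (by
      intro f hf
      rcases mem_insert.1 hf with rfl | hf
      · right; simp
      · left
        rw [mem_erase] at hf
        have := hpriv f hf.2 hf.1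
        intro z hz hzP
        simp only [hP, mem_insert, mem_singleton] at hzP
        rcases hzP with rfl | rfl
        · exact this.1 hz
        · exact this.2 hz)
    rw [empty_union, sdiff_union_self_eq_union] at h₃
    refine (h₃.subset subset_union_left).mono Subset.rfl fun f hf _ => ?_
    by_cases hfe : f = e
    · exact ⟨P, mem_insert_self _ _, hfe ▸ hPe⟩
    · exact ⟨f, by simp [hf, hfe], Subset.rfl⟩

end AvoiderEnforcer

/-! ### Trees of 3-edges and winning families with an odd number of vertices. -/

namespace AvoiderEnforcer

open Finset

variable {α : Type*} [DecidableEq α]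

/-- `Grow E V₀ T₀ V T`: the vertex set `V` and the edge set `T` arise from `V₀` and `T₀` by
successively adding edges of size 3 of `E` that meet the current vertex set in exactly one vertex. -/
inductive Grow (E : Finset (Finset α)) (V₀ : Finset α) (T₀ : Finset (Finset α)) :
    Finset α → Finset (Finset α) → Prop
  | base : Grow E V₀ T₀ V₀ T₀
  | step {V : Finset α} {T : Finset (Finset α)} {g : Finset α} (h : Grow E V₀ T₀ V T)
      (hg : g ∈ E) (hg3 : g.card = 3) (hgV : (g ∩ V).card = 1) :
      Grow E V₀ T₀ (V ∪ g) (insert g T)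

/-- Any two distinct edges share at most one vertex. -/
def Linear (E : Finset (Finset α)) : Prop :=
  ∀ e ∈ E, ∀ f ∈ E, e ≠ f → (e ∩ f).card ≤ 1

/-- The edges in `E` connect all the vertices of `R`. -/
def Connects (E : Finset (Finset α)) (R : Finset α) : Prop :=
  ∀ S ⊆ R, S.Nonempty → (∀ e ∈ E, (e ∩ S).Nonempty → e ⊆ S) → S = R

variable {E T₀ T C : Finset (Finset α)} {V₀ V R : Finset α} {x : α}

theorem Linear.subset (h : Linear E) (hT : T ⊆ E) : Linear T :=
  fun e he f hf => h e (hT he) f (hT hf)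

theorem Linear.eq {e f : Finset α} (h : Linear E) (he : e ∈ E) (hf : f ∈ E) {u v : α} (huv : u ≠ v)
    (hue : u ∈ e) (hve : v ∈ e) (huf : u ∈ f) (hvf : v ∈ f) : e = f := by
  by_contra hne
  have := card_le_one.1 (h e he f hf hne) u (by simp [hue, huf]) v (by simp [hve, hvf])
  exact huv this

namespace Grow

theorem subset_vertices (h : Grow E V₀ T₀ V T) : V₀ ⊆ V := by
  induction h with
  | base => exact Subset.rfl
  | step _ _ _ _ ih => exact ih.trans subset_union_left

theorem edges_subset (h : Grow E V₀ T₀ V T) (h₀ : T₀ ⊆ E) : T ⊆ E := by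
  induction h with
  | base => exact h₀
  | step _ hg _ _ ih => exact insert_subset hg ih

theorem edge_subset (h : Grow E V₀ T₀ V T) (h₀ : ∀ e ∈ T₀, e ⊆ V₀) : ∀ e ∈ T, e ⊆ V := by
  induction h with
  | base => exact h₀
  | step _ _ _ _ ih =>
    intro e he
    rcases mem_insert.1 he with rfl | he
    · exact subset_union_right
    · exact (ih e he).trans subset_union_left

theorem vertices_subset (h : Grow E V₀ T₀ V T) (h₀ : V₀ ⊆ R) (hE : ∀ e ∈ E, e ⊆ R) : V ⊆ R := by
  induction h with
  | base => exact h₀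
  | step _ hg _ _ ih => exact union_subset ih (hE _ hg)

theorem card_vertices_step {g : Finset α} (hg3 : g.card = 3) (hgV : (g ∩ V).card = 1) :
    (V ∪ g).card = V.card + 2 := by
  have := card_union_add_card_inter V g
  rw [inter_comm] at this
  omega

theorem notMem_of_card_inter {g : Finset α} (hT : ∀ e ∈ T, e ⊆ V) (hg3 : g.card = 3)
    (hgV : (g ∩ V).card = 1) : g ∉ T := by
  intro hg
  rw [inter_eq_left.2 (hT g hg)] at hgV
  omega

/-- Each step adds two vertices and one edge, so the difference of `V.card` and `2 * T.card` is
invariant: it is 1 for a tree grown from a vertex, and 0 when the start is balanced. -/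
theorem card_add (h : Grow E V₀ T₀ V T) (h₀ : ∀ e ∈ T₀, e ⊆ V₀) :
    V.card + 2 * T₀.card = V₀.card + 2 * T.card := by
  induction h with
  | base => rfl
  | step h hg hg3 hgV ih =>
    rw [card_vertices_step hg3 hgV,
      card_insert_of_notMem (notMem_of_card_inter (h.edge_subset h₀) hg3 hgV)]
    omega

theorem exists_maximal (h₀ : V₀ ⊆ R) (hE : ∀ e ∈ E, e ⊆ R) :
    ∃ V T, Grow E V₀ T₀ V T ∧ ∀ g ∈ E, g.card = 3 → (g ∩ V).card ≠ 1 := by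
  by_contra! hcon
  have : ∀ n, ∃ V T, Grow E V₀ T₀ V T ∧ n ≤ V.card := by
    intro n
    induction n with
    | zero => exact ⟨V₀, T₀, base, Nat.zero_le _⟩
    | succ n ih =>
      obtain ⟨V, T, h, hn⟩ := ih
      obtain ⟨g, hg, hg3, hgV⟩ := hcon V T h
      exact ⟨_, _, h.step hg hg3 hgV, by rw [card_vertices_step hg3 hgV]; omega⟩
  obtain ⟨V, T, h, hn⟩ := this (R.card + 1)
  have := card_le_card (h.vertices_subset h₀ hE)
  omega

theorem odd_card (h : Grow C {x} ∅ V T) : Odd V.card := by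
  have := h.card_add (by simp)
  rw [card_singleton, card_empty] at this
  exact ⟨T.card, by omega⟩

/-- If Avoider owns two vertices of a tree of edges of size 3 then she loses. -/
theorem not_wins_pair (h : Grow C {x} ∅ V T) {z : α} (hz : z ∈ V) (hzx : z ≠ x) :
    ¬ Wins C {x, z} (V \ {x, z}) := by
  have hmono : ∀ {U W A : Finset α}, U ⊆ W ∪ A → ∀ z', {x, z'} ⊆ A →
      ¬ Wins C {x, z'} (U \ {x, z'}) → ¬ Wins C A W := by
    intro U W A hU z' hA hn hw
    exact hn (hw.weaken hA (sdiff_subset.trans hU))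
  induction h generalizing z with
  | base => simp [hzx] at hz
  | @step V T g h hg hg3 hgV ih =>
    obtain ⟨u, hu⟩ := card_eq_one.1 hgV
    have hug : u ∈ g ∧ u ∈ V := by
      have : u ∈ g ∩ V := by simp [hu]
      simpa using this
    have hxV : x ∈ V := h.subset_vertices (mem_singleton_self x)
    by_cases hzV : z ∈ V
    · refine hmono ?_ z Subset.rfl (ih hzV hzx)
      intro w hw
      by_cases hw' : w ∈ ({x, z} : Finset α) <;> grind
    have hzg : z ∈ g := (mem_union.1 hz).resolve_left hzV
    have huz : u ≠ z := fun h => hzV (h ▸ hug.2)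
    obtain ⟨w, hw⟩ : ∃ w, g = {u, z, w} ∧ w ≠ u ∧ w ≠ z := by
      have : ((g.erase u).erase z).card = 1 := by
        rw [card_erase_of_mem (by simp [hzg, huz.symm]), card_erase_of_mem hug.1, hg3]
      obtain ⟨w, hw⟩ := card_eq_one.1 this
      have hwg : w ∈ (g.erase u).erase z := by simp [hw]
      simp only [mem_erase] at hwg
      refine ⟨w, ?_, hwg.2.1, hwg.1⟩
      rw [← hw, insert_erase (by simp [hzg, huz.symm]), insert_erase hug.1]
    obtain ⟨rfl, hwu, hwz⟩ := hw
    have hwV : w ∉ V := by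
      intro hwV
      have : w ∈ ({u, z, w} : Finset α) ∩ V := by simp [hwV]
      rw [hu, mem_singleton] at this
      exact hwu this
    have hVodd : Odd V.card := h.odd_card
    have hR : (V ∪ {u, z, w}) \ {x, z} = insert w (V.erase x) := by
      ext t; simp only [mem_sdiff, mem_union, mem_insert, mem_singleton, mem_erase]
      grind
    rw [hR]
    intro hw
    have hodd : Odd (insert w (V.erase x)).card := by
      rw [card_insert_of_notMem (by simp [hwV])]
      exact (even_card_erase hVodd hxV).add_one
    obtain ⟨t, ht, hw⟩ := (wins_of_odd hodd).1 hw
    -- The move `w` leaves only `u` missing from the last edge; any other move gives Avoider the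
    -- root and a second vertex of the smaller tree.
    rcases eq_or_ne t w with rfl | htw
    · refine not_wins_of_card_sdiff_le_one hg ?_ ?_ hw
      · intro s; simp only [mem_insert, mem_singleton, mem_union, mem_erase]; grind
      · refine (card_le_card (t := {u}) ?_).trans (by simp)
        intro s; simp only [mem_insert, mem_singleton, mem_sdiff]; grind
    · have htV : t ∈ V ∧ t ≠ x := by simp [htw] at ht; exact ⟨ht.2, ht.1⟩
      refine hmono ?_ t ?_ (ih htV.1 htV.2) hw
      · intro s; simp only [mem_insert, mem_singleton, mem_union, mem_erase]; grind
      · intro s; simp only [mem_insert, mem_singleton]; grind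

theorem self_mem (h : Grow C {x} ∅ V T) : x ∈ V := h.subset_vertices (mem_singleton_self x)

/-- If all free vertices but `v` are in a tree containing a vertex of Avoider, then her only
possible winning move is `v`. -/
theorem wins_insert (h : Grow C {x} ∅ V T) {v : α} (hv : v ∉ V) {A W : Finset α} (hx : x ∈ A)
    (hVW : insert v V ⊆ W ∪ A) (hw : Wins C A W) : Wins C (insert v A) (V.erase x) := by
  have hw' : Wins C A (insert v (V.erase x)) :=
    hw.weaken Subset.rfl ((insert_subset_insert _ (erase_subset _ _)).trans hVW)
  have hodd : Odd (insert v (V.erase x)).card := by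
    rw [card_insert_of_notMem (by simp [hv])]
    exact (even_card_erase h.odd_card h.self_mem).add_one
  obtain ⟨t, ht, hwt⟩ := (wins_of_odd hodd).1 hw'
  rcases eq_or_ne t v with rfl | htv
  · rwa [erase_insert (by simp [hv])] at hwt
  · have htV : t ∈ V ∧ t ≠ x := by simp [htv] at ht; exact ⟨ht.2, ht.1⟩
    refine absurd (hwt.weaken ?_ ?_) (h.not_wins_pair htV.1 htV.2)
    · intro s; simp only [mem_insert, mem_singleton]; grind
    · intro s; simp only [mem_insert, mem_singleton, mem_union, mem_erase, mem_sdiff]; grind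

/-- The forced move `v` brings Avoider within one vertex of completing `e`, while the rest of `e` is
still out of Enforcer's hands. -/
theorem not_wins_of_close (h : Grow C {x} ∅ V T) {v : α} (hv : v ∉ V) {A W e : Finset α}
    (hx : x ∈ A) (hVW : insert v V ⊆ W ∪ A) (he : e ∈ C) (heV : e ⊆ insert v A ∪ V)
    (hcard : (e \ insert v A).card ≤ 1) : ¬ Wins C A W := by
  intro hw
  refine not_wins_of_card_sdiff_le_one he (heV.trans ?_) hcard (h.wins_insert hv hx hVW hw)
  intro s; simp only [mem_insert, mem_union, mem_erase]; grind

/-- Consider the first step at which `e` meets the tree twice. By linearity it has one vertex `u` in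
the old tree and one vertex `v` that is new in `g`, and at most one vertex outside; forced moves
then complete it. -/
theorem card_inter_le_one (hlin : Linear C) (hcard : ∀ e ∈ C, e.card ≤ 3) {W : Finset α}
    (hCW : ∀ e ∈ C, e ⊆ W ∪ {x}) (hw : Wins C {x} W) (h : Grow C {x} ∅ V T) :
    ∀ e ∈ C, e ∉ T → (e ∩ V).card ≤ 1 := by
  have hVW : ∀ {V T}, Grow C {x} ∅ V T → V ⊆ W ∪ {x} := fun h =>
    h.vertices_subset subset_union_right hCW
  induction h with
  | base => exact fun e _ _ => (card_le_card inter_subset_right).trans (by simp)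
  | @step V T g h hg hg3 hgV ih =>
    intro e he heT
    rw [mem_insert, not_or] at heT
    have h1 := ih e he heT.2
    have h2 := hlin e he g hg heT.1
    by_contra! hcon
    have hsplit : e ∩ (V ∪ g) = (e ∩ V) ∪ (e ∩ g) := inter_union_distrib_left _ _ _
    have h3 := card_union_le (e ∩ V) (e ∩ g)
    rw [← hsplit] at h3
    obtain ⟨u, hu⟩ := card_eq_one.1 (show (e ∩ V).card = 1 by omega)
    obtain ⟨v, hv⟩ := card_eq_one.1 (show (e ∩ g).card = 1 by omega)
    have huV : u ∈ e ∧ u ∈ V := by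
      have : u ∈ e ∩ V := by simp [hu]
      simpa using this
    have hvg : v ∈ e ∧ v ∈ g := by
      have : v ∈ e ∩ g := by simp [hv]
      simpa using this
    have huv : u ≠ v := by
      rintro rfl
      rw [hsplit, hu, hv, union_self, card_singleton] at hcon
      omega
    have hvV : v ∉ V := by
      intro hvV
      have : v ∈ e ∩ V := by simp [hvg.1, hvV]
      rw [hu, mem_singleton] at this
      exact huv this.symm
    have hVg := hVW (h.step hg hg3 hgV)
    have hc : (e \ (V ∪ g)).card ≤ 1 := by
      have := card_sdiff_add_card_inter e (V ∪ g)
      have := hcard e he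
      omega
    have heuv : ∀ s ∈ e, s ∈ V ∪ g → s = u ∨ s = v := by
      intro s hs hsV
      have : s ∈ e ∩ (V ∪ g) := by simp [hs, mem_union.1 hsV]
      rw [hsplit, hu, hv] at this
      simpa using this
    rcases (e \ (V ∪ g)).eq_empty_or_nonempty with h0 | ⟨w, hwe⟩
    · rw [sdiff_eq_empty_iff_subset] at h0
      refine h.not_wins_of_close hvV (mem_singleton_self x) ?_ he ?_ ?_ hw
      · exact insert_subset (hVg (mem_union_right _ hvg.2)) (subset_union_left.trans hVg)
      · intro s hs
        rcases heuv s hs (h0 hs) with rfl | rfl <;> simp [huV.2]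
      · refine (card_le_card (t := {u}) fun s hs => ?_).trans (by simp)
        simp only [mem_sdiff, mem_insert, mem_singleton, not_or] at hs ⊢
        exact (heuv s hs.1 (h0 hs.1)).resolve_right hs.2.1
    · have hwe' := mem_sdiff.1 hwe
      have hewuv : ∀ s ∈ e, s = u ∨ s = v ∨ s = w := by
        intro s hs
        by_cases hsV : s ∈ V ∪ g
        · rcases heuv s hs hsV with h | h <;> simp [h]
        · exact Or.inr (Or.inr (card_le_one.1 hc s (mem_sdiff.2 ⟨hs, hsV⟩) w hwe))
      -- Two forced moves: first `w`, against the tree with `g`, then `v`, against the tree without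
      -- `g`. Only `u` is then missing from `e`.
      have hw2 := (h.step hg hg3 hgV).wins_insert hwe'.2 (mem_singleton_self x)
        (insert_subset (hCW e he hwe'.1) hVg) hw
      refine h.not_wins_of_close hvV (by simp) ?_ he ?_ ?_ hw2
      · intro s; simp only [mem_insert, mem_singleton, mem_union, mem_erase]; grind
      · intro s hs
        rcases hewuv s hs with rfl | rfl | rfl <;> simp [huV.2]
      · refine (card_le_card (t := {u}) fun s hs => ?_).trans (by simp)
        simp only [mem_sdiff, mem_insert, mem_singleton, not_or] at hs ⊢
        rcases hewuv s hs.1 with h | h | h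
        · exact h
        · exact absurd h hs.2.1
        · exact absurd h hs.2.2.1

end Grow

theorem Wins.two_le_card (hw : Wins E ∅ R) {e : Finset α} (he : e ∈ E) (heR : e ⊆ R) :
    2 ≤ e.card := by
  by_contra hcon
  exact not_wins_of_card_sdiff_le_one he (by simpa using heR) (by simp; omega) hw

/-- If Avoider wins as last player on a connected family of edges with an odd number of vertices,
then this family is a tree of edges of size 3. -/
theorem card_vertices_of_odd (hlin : Linear C) (hcard : ∀ e ∈ C, e.card ≤ 3)
    (hCR : ∀ e ∈ C, e ⊆ R) (hconn : Connects C R) (hodd : Odd R.card) (hw : Wins C ∅ R) :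
    (∀ e ∈ C, e.card = 3) ∧ R.card = 2 * C.card + 1 := by
  have h2 : ∀ e ∈ C, 2 ≤ e.card := fun e he => hw.two_le_card he (hCR e he)
  obtain ⟨x, hx, hwx⟩ := (wins_of_odd hodd).1 hw
  rw [insert_empty] at hwx
  have hRx : R.erase x ∪ {x} = R := by
    rw [union_comm, ← insert_eq, insert_erase hx]
  have hCR' : ∀ e ∈ C, e ⊆ R.erase x ∪ {x} := by rwa [hRx]
  obtain ⟨V, T, h, hmax⟩ := Grow.exists_maximal (E := C) (T₀ := ∅) (V₀ := {x}) (R := R)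
    (by simpa using hx) hCR
  have hTV := h.edge_subset (by simp)
  -- An edge outside the tree that touches it does so once, hence has size 2 by maximality, and its
  -- outer vertex would be a forced move.
  have hT : ∀ e ∈ C, (e ∩ V).Nonempty → e ∈ T := by
    intro e he hne
    by_contra heT
    have h1 := h.card_inter_le_one hlin hcard hCR' hwx e he heT
    have h1' : (e ∩ V).card = 1 := le_antisymm h1 hne.card_pos
    have h3 := hmax e he
    have : e.card = 2 := by
      have := hcard e he
      have := h2 e he
      have : e.card ≠ 3 := fun h => h3 h h1'
      omega
    have hc := card_sdiff_add_card_inter e V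
    obtain ⟨v, hv⟩ := card_eq_one.1 (show (e \ V).card = 1 by omega)
    have hve : v ∈ e ∧ v ∉ V := by
      have : v ∈ e \ V := by simp [hv]
      simpa using this
    refine h.not_wins_of_close hve.2 (mem_singleton_self x) ?_ he ?_ ?_ hwx
    · exact insert_subset (hCR' e he hve.1) ((h.vertices_subset (by simpa using hx) hCR).trans hRx.ge)
    · intro s hs
      by_cases hsV : s ∈ V
      · simp [hsV]
      · have : s ∈ e \ V := by simp [hs, hsV]
        rw [hv, mem_singleton] at this
        simp [this]
    · refine (card_le_card (t := e.erase v) ?_).trans (by rw [card_erase_of_mem hve.1]; omega)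
      intro s; simp only [mem_sdiff, mem_insert, mem_erase]; grind
  have hVR : V = R := hconn V (h.vertices_subset (by simpa using hx) hCR) ⟨x, h.self_mem⟩
    fun e he hne => hTV e (hT e he hne)
  have hTC : T = C := by
    refine (h.edges_subset (by simp)).antisymm fun e he => hT e he ?_
    rw [hVR, inter_eq_left.2 (hCR e he)]
    exact card_pos.1 (by have := h2 e he; omega)
  have hT3 : ∀ e ∈ T, e.card = 3 := by
    clear hmax hTV hT hVR hTC
    induction h with
    | base => simp
    | step _ _ hg3 _ ih =>
      intro e he
      rcases mem_insert.1 he with rfl | he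
      · exact hg3
      · exact ih e he
  refine ⟨hTC ▸ hT3, ?_⟩
  have := h.card_add (by simp)
  rw [card_singleton, card_empty, hVR, hTC] at this
  omega

end AvoiderEnforcer

/-! ### Balanced subfamilies: twice as many vertices as edges. -/

namespace AvoiderEnforcer

open Finset

variable {α : Type*} [DecidableEq α]

variable {E T₀ T C : Finset (Finset α)} {V₀ V R : Finset α} {x : α}

/-- Every edge of size 3 has at most one vertex which belongs to no other edge. -/
def Reduced (E : Finset (Finset α)) : Prop :=
  ∀ g ∈ E, g.card = 3 → ∀ u ∈ g, ∀ v ∈ g, (∀ f ∈ E, u ∈ f → f = g) → (∀ f ∈ E, v ∈ f → f = g) →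
    u = v

theorem Connects.insert {e : Finset α} (h : Connects T V) (hTV : ∀ f ∈ T, f ⊆ V)
    (he : (e ∩ V).Nonempty) : Connects (insert e T) (V ∪ e) := by
  intro S hS hSne hcl
  have hSV : (S ∩ V).Nonempty := by
    obtain ⟨s, hs⟩ := hSne
    rcases mem_union.1 (hS hs) with hsV | hse
    · exact ⟨s, by simp [hs, hsV]⟩
    · have : e ⊆ S := hcl e (mem_insert_self _ _) ⟨s, by simp [hs, hse]⟩
      obtain ⟨t, ht⟩ := he
      rw [mem_inter] at ht
      exact ⟨t, by simp [this ht.1, ht.2]⟩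
  have hVS : S ∩ V = V := by
    refine h _ inter_subset_right hSV fun f hf hne => subset_inter ?_ (hTV f hf)
    exact hcl f (mem_insert_of_mem hf) (hne.mono (inter_subset_inter_left inter_subset_left))
  rw [inter_eq_right] at hVS
  refine hS.antisymm (union_subset hVS (hcl e (mem_insert_self _ _) ?_))
  exact he.mono (inter_subset_inter_left hVS)

/-- No edge adds exactly one vertex to a connected family with twice as many vertices as edges. -/
theorem card_sdiff_ne_one (hlin : Linear E) (hcard : ∀ e ∈ E, e.card ≤ 3) (hER : ∀ e ∈ E, e ⊆ R)
    (hw : Wins E ∅ R) (hTE : T ⊆ E) (hVR : V ⊆ R) (hTV : ∀ f ∈ T, f ⊆ V) (hconn : Connects T V)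
    (hV : V.card = 2 * T.card) {e : Finset α} (he : e ∈ E) (hne : (e ∩ V).Nonempty) :
    (e \ V).card ≠ 1 := by
  intro h1
  have hsub : insert e T ⊆ E := insert_subset he hTE
  have hVe : (V ∪ e).card = V.card + 1 := by
    rw [← union_sdiff_self_eq_union, card_union_of_disjoint disjoint_sdiff, h1]
  have heT : e ∉ T := fun h => by
    rw [sdiff_eq_empty_iff_subset.2 (hTV e h)] at h1
    simp at h1
  -- The enlarged family has `2 * T.card + 1` vertices but `T.card + 1` edges, one too many for a
  -- tree.
  have := (card_vertices_of_odd (C := insert e T) (R := V ∪ e) (hlin.subset hsub)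
    (fun f hf => hcard f (hsub hf)) ?_ (hconn.insert hTV hne) ?_
    ((hw.edges hsub).subset (union_subset hVR (hER e he)))).2
  · rw [card_insert_of_notMem heT, hVe] at this
    omega
  · intro f hf
    rcases mem_insert.1 hf with rfl | hf
    · exact subset_union_right
    · exact (hTV f hf).trans subset_union_left
  · rw [hVe, hV]
    exact ⟨T.card, rfl⟩

/-- In a reduced linear family where Avoider wins as last player, no edge leaves a connected
subfamily with twice as many vertices as edges. -/
theorem subset_of_inter_nonempty (hlin : Linear E) (hcard : ∀ e ∈ E, e.card ≤ 3)
    (hred : Reduced E) (hER : ∀ e ∈ E, e ⊆ R) (hw : Wins E ∅ R) (hTE : T₀ ⊆ E) (hVR : V₀ ⊆ R)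
    (hTV : ∀ f ∈ T₀, f ⊆ V₀) (hconn : Connects T₀ V₀) (hV : V₀.card = 2 * T₀.card)
    {e : Finset α} (he : e ∈ E) (hne : (e ∩ V₀).Nonempty) : e ⊆ V₀ := by
  have h2 : ∀ e ∈ E, 2 ≤ e.card := fun e he => hw.two_le_card he (hER e he)
  have hcardV : ∀ {V T}, Grow E V₀ T₀ V T → V.card = 2 * T.card := fun h => by
    have := h.card_add hTV
    omega
  have hconnV : ∀ {V T}, Grow E V₀ T₀ V T → Connects T V := fun h => by
    induction h with
    | base => exact hconn
    | step h hg hg3 hgV ih => exact ih.insert (h.edge_subset hTV) (card_pos.1 (by omega))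
  have hne1 : ∀ {V T}, Grow E V₀ T₀ V T → ∀ e ∈ E, (e ∩ V).Nonempty → (e \ V).card ≠ 1 :=
    fun h e he hne => card_sdiff_ne_one hlin hcard hER hw (h.edges_subset hTE)
      (h.vertices_subset hVR hER) (h.edge_subset hTV) (hconnV h) (hcardV h) he hne
  have hle : ∀ {V T}, Grow E V₀ T₀ V T → ∀ e ∈ E, e ∉ T → ¬ e ⊆ V₀ → (e ∩ V).card ≤ 1 := by
    intro V T h
    induction h with
    | base =>
      intro e he _ heV
      by_contra! hcon
      have hc := card_sdiff_add_card_inter e V₀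
      have := hcard e he
      have hpos : 0 < (e \ V₀).card := by
        rw [card_pos, sdiff_nonempty]; exact heV
      exact hne1 .base e he (card_pos.1 (by omega)) (by omega)
    | @step V T g h hg hg3 hgV ih =>
      intro e he heT heV
      rw [mem_insert, not_or] at heT
      have i1 := ih e he heT.2 heV
      have i2 := hlin e he g hg heT.1
      by_contra! hcon
      have i3 := card_union_le (e ∩ V) (e ∩ g)
      rw [← inter_union_distrib_left] at i3
      have hc := card_sdiff_add_card_inter e V
      have hc' := card_sdiff_add_card_inter e (V ∪ g)
      have := hcard e he
      have := h2 e he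
      -- Here `e` has one vertex in `V` and another one in `g`. If its size is 3 it adds one vertex
      -- to `V ∪ g`; if its size is 2 it already added one to `V`.
      have n1 := hne1 h e he (card_pos.1 (by omega))
      have n2 := hne1 (h.step hg hg3 hgV) e he (card_pos.1 (by omega))
      omega
  obtain ⟨V, T, h, hmax⟩ := Grow.exists_maximal (E := E) (T₀ := T₀) hVR hER
  have hdisj : ∀ e ∈ E, e ∉ T → ¬ e ⊆ V₀ → ¬ (e ∩ V).Nonempty := by
    intro e he heT heV hne
    have i1 := hle h e he heT heV
    have i2 := hne.card_pos
    have i3 := hne1 h e he hne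
    have i4 := hmax e he
    have hc := card_sdiff_add_card_inter e V
    have := hcard e he
    have := h2 e he
    omega
  by_contra heV
  cases h with
  | base =>
    have heT : e ∉ T₀ := fun h => heV (hTV e h)
    exact hdisj e he heT heV hne
  | @step V T g h hg hg3 hgV =>
    have hc := card_sdiff_add_card_inter g V
    -- The two vertices that the last edge `g` added lie in no other edge, against reducedness.
    obtain ⟨u, hu, v, hv, huv⟩ := one_lt_card.1 (show 1 < (g \ V).card by omega)
    have key : ∀ s ∈ g \ V, ∀ f ∈ E, s ∈ f → f = g := by
      intro s hs f hf hsf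
      rw [mem_sdiff] at hs
      by_contra hfg
      refine hdisj f hf ?_ (fun hfV => hs.2 (h.subset_vertices (hfV hsf))) ⟨s, ?_⟩
      · rw [mem_insert, not_or]
        exact ⟨hfg, fun hfT => hs.2 (h.edge_subset hTV f hfT hsf)⟩
      · simp [hsf, hs.1]
    exact huv (hred g hg hg3 u (mem_sdiff.1 hu).1 v (mem_sdiff.1 hv).1 (key u hu) (key v hv))

end AvoiderEnforcer

/-! ### Paths of 3-edges and the existence of a cycle. -/

namespace AvoiderEnforcer

open Finset

variable {α : Type*} [DecidableEq α]

variable {E : Finset (Finset α)} {R : Finset α} {v : ℕ → α} {k l : ℕ}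

/-- The edge formed by the terms `2 * i`, `2 * i + 1` and `2 * i + 2` of a sequence of vertices. -/
def block (v : ℕ → α) (i : ℕ) : Finset α := {v (2 * i), v (2 * i + 1), v (2 * i + 2)}

theorem mem_block {i : ℕ} {w : α} :
    w ∈ block v i ↔ w = v (2 * i) ∨ w = v (2 * i + 1) ∨ w = v (2 * i + 2) := by
  simp [block]

/-- `v 0, …, v (2 * k)` is a sequence of distinct vertices whose blocks are edges. -/
structure IsPathSeq (E : Finset (Finset α)) (v : ℕ → α) (k : ℕ) : Prop where
  inj : ∀ a ≤ 2 * k, ∀ b ≤ 2 * k, v a = v b → a = b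
  mem : ∀ i < k, block v i ∈ E

/-- `v 0, …, v (2 * l) = v 0` is a closed sequence of vertices without other repetition. -/
structure IsCycleSeq (v : ℕ → α) (l : ℕ) : Prop where
  three_le : 3 ≤ l
  closed : v (2 * l) = v 0
  inj : ∀ a < 2 * l, ∀ b < 2 * l, v a = v b → a = b

namespace IsPathSeq

/-- A block ignores the order of its entries, so either of the last two vertices can serve as the
end of the path. -/
theorem swap_last (h : IsPathSeq E v k) (hk : 1 ≤ k) :
    IsPathSeq E (v ∘ Equiv.swap (2 * k - 1) (2 * k)) k := by
  have hs : ∀ a, a < 2 * k - 1 → Equiv.swap (2 * k - 1) (2 * k) a = a := fun a ha =>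
    Equiv.swap_apply_of_ne_of_ne (by omega) (by omega)
  have hle : ∀ a, a ≤ 2 * k → Equiv.swap (2 * k - 1) (2 * k) a ≤ 2 * k := fun a ha => by
    rw [Equiv.swap_apply_def]; split_ifs <;> omega
  refine ⟨fun a ha b hb hab => (Equiv.swap (2 * k - 1) (2 * k)).injective
    (h.inj _ (hle a ha) _ (hle b hb) hab), fun i hi => ?_⟩
  have := h.mem i hi
  convert this using 1
  rcases Nat.lt_or_ge (i + 1) k with hik | hik
  · simp only [block, Function.comp, hs (2 * i) (by omega), hs (2 * i + 1) (by omega),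
      hs (2 * i + 2) (by omega)]
  · have e1 : 2 * i + 1 = 2 * k - 1 := by omega
    have e2 : 2 * i + 2 = 2 * k := by omega
    simp only [block, Function.comp, hs (2 * i) (by omega), e1, e2, Equiv.swap_apply_left,
      Equiv.swap_apply_right]
    rw [pair_comm]

theorem swap_first (h : IsPathSeq E v k) (hk : 1 ≤ k) :
    IsPathSeq E (v ∘ Equiv.swap 0 1) k := by
  have hs : ∀ a, 1 < a → Equiv.swap 0 1 a = a := fun a ha =>
    Equiv.swap_apply_of_ne_of_ne (by omega) (by omega)
  have hle : ∀ a, a ≤ 2 * k → Equiv.swap 0 1 a ≤ 2 * k := fun a ha => by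
    rw [Equiv.swap_apply_def]; split_ifs <;> omega
  refine ⟨fun a ha b hb hab => (Equiv.swap 0 1).injective
    (h.inj _ (hle a ha) _ (hle b hb) hab), fun i hi => ?_⟩
  have := h.mem i hi
  convert this using 1
  rcases Nat.eq_zero_or_pos i with rfl | hi0
  · simp only [block, Function.comp, mul_zero, zero_add, Equiv.swap_apply_left,
      Equiv.swap_apply_right, hs 2 (by omega)]
    rw [insert_comm]
  · simp only [block, Function.comp, hs (2 * i) (by omega), hs (2 * i + 1) (by omega),
      hs (2 * i + 2) (by omega)]

theorem shift (h : IsPathSeq E v k) {i : ℕ} (hi : i ≤ k) :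
    IsPathSeq E (fun a => v (2 * i + a)) (k - i) := by
  refine ⟨fun a ha b hb hab => ?_, fun j hj => ?_⟩
  · have := h.inj _ (by omega) _ (by omega) hab
    omega
  · have := h.mem (i + j) (by omega)
    simpa [block, mul_add, add_assoc] using this

/-- An edge of size 3 through both ends of a path closes it to a cycle. -/
theorem exists_cycleSeq_of_ends (h : IsPathSeq E v k) (hk : 2 ≤ k) {f : Finset α} (hf : f ∈ E)
    (hf3 : f.card = 3) (h0 : v 0 ∈ f) (h1 : v (2 * k) ∈ f)
    (hother : ∀ a ≤ 2 * k, v a ∈ f → a = 0 ∨ a = 2 * k) :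
    ∃ w l, IsCycleSeq w l ∧ ∀ i < l, block w i ∈ E := by
  have hne : v 0 ≠ v (2 * k) := fun h' => by
    have := h.inj _ (by omega) _ le_rfl h'
    omega
  obtain ⟨t, ht⟩ := card_eq_one.1 (show ((f.erase (v 0)).erase (v (2 * k))).card = 1 by
    rw [card_erase_of_mem (by simp [h1, hne.symm]), card_erase_of_mem h0, hf3])
  have htf : t ∈ (f.erase (v 0)).erase (v (2 * k)) := by simp [ht]
  simp only [mem_erase] at htf
  have hft : f = {v (2 * k), t, v 0} := by
    rw [← insert_erase h0, ← insert_erase (show v (2 * k) ∈ f.erase (v 0) by simp [h1, hne.symm]),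
      ht]
    ext; simp; tauto
  have htv : ∀ a ≤ 2 * k, v a ≠ t := by
    intro a ha hat
    rcases hother a ha (hat ▸ htf.2.2) with rfl | rfl
    · exact htf.2.1 hat.symm
    · exact htf.1 hat.symm
  -- The closing edge becomes block `k`, with middle vertex `t`; the default value `v 0` provides
  -- the closure at index `2 * k + 2`.
  refine ⟨fun a => if a ≤ 2 * k then v a else if a = 2 * k + 1 then t else v 0, k + 1,
    ⟨by omega, ?_, ?_⟩, fun i hi => ?_⟩
  · simp [show ¬ 2 * (k + 1) ≤ 2 * k by omega, show ¬ 2 * (k + 1) = 2 * k + 1 by omega]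
  · intro a ha b hb hab
    split_ifs at hab with c1 c2 c3 c4 c5 c6
    · exact h.inj _ c1 _ c2 hab
    · exact absurd hab (htv a c1)
    · omega
    · exact absurd hab.symm (htv b c5)
    · omega
    all_goals omega
  · rcases Nat.lt_or_ge i k with hik | hik
    · have := h.mem i hik
      simpa [block, show 2 * i ≤ 2 * k by omega, show 2 * i + 1 ≤ 2 * k by omega,
        show 2 * i + 2 ≤ 2 * k by omega] using this
    · obtain rfl : i = k := by omega
      rw [hft] at hf
      simpa [block, show ¬ 2 * i + 1 ≤ 2 * i by omega, show ¬ 2 * i + 2 ≤ 2 * i by omega] using hf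

/-- If a further edge passes through the end of a path then it yields a longer path or a cycle. -/
theorem extend_or_cycle (hlin : Linear E) (h3 : ∀ e ∈ E, e.card = 3) (h : IsPathSeq E v k)
    (hk : 1 ≤ k) {f : Finset α} (hf : f ∈ E) (hfv : v (2 * k) ∈ f) (hne : f ≠ block v (k - 1)) :
    (∃ w, IsPathSeq E w (k + 1)) ∨ ∃ w l, IsCycleSeq w l ∧ ∀ i < l, block w i ∈ E := by
  have hlast : v (2 * k) ∈ block v (k - 1) := by
    rw [mem_block]; right; right; congr 1; omega
  have hf1 : ∀ w ∈ block v (k - 1), w ∈ f → w = v (2 * k) := by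
    intro w hw hwf
    by_contra hwv
    exact hne (hlin.eq hf (h.mem _ (by omega)) hwv hwf hfv hw hlast)
  by_cases hJ : ∃ i < k - 1, (f ∩ block v i).Nonempty
  · right
    -- Taking the last block met by `f` makes the path from there on meet `f` in block `i` and at
    -- the far end only.
    obtain ⟨i, ⟨hi, hne⟩, hmax⟩ : ∃ i, (i < k - 1 ∧ (f ∩ block v i).Nonempty) ∧
        ∀ j, i < j → j < k - 1 → ¬ (f ∩ block v j).Nonempty := by
      classical
      obtain ⟨i, hi, hne⟩ := hJ
      have hsp := Nat.findGreatest_spec (P := fun i => i < k - 1 ∧ (f ∩ block v i).Nonempty)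
        (n := k) (by omega) ⟨hi, hne⟩
      refine ⟨_, hsp, fun j hj hjk hj' => ?_⟩
      exact Nat.findGreatest_is_greatest hj (by omega) ⟨hjk, hj'⟩
    obtain ⟨w, hw⟩ := hne
    rw [mem_inter] at hw
    have hfi : f ≠ block v i := by
      rintro rfl
      rcases mem_block.1 hfv with h' | h' | h' <;>
      · have := h.inj _ (by omega) _ (by omega) h'
        omega
    have hrest : ∀ a, 2 * i + 2 ≤ a → a ≤ 2 * k → v a ∈ f → a = 2 * k := by
      intro a ha hak haf
      by_cases hak' : a < 2 * k - 2
      · refine absurd ⟨v a, ?_⟩ (hmax (a / 2) (by omega) (by omega))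
        rw [mem_inter, mem_block]
        refine ⟨haf, ?_⟩
        rcases Nat.even_or_odd' a with ⟨c, rfl | rfl⟩
        · left; congr 1; omega
        · right; left; congr 1; omega
      · refine h.inj _ (by omega) _ (by omega) (hf1 _ ?_ haf)
        rw [mem_block]
        obtain h' | h' | h' : a = 2 * (k - 1) ∨ a = 2 * (k - 1) + 1 ∨ a = 2 * (k - 1) + 2 := by omega
        · left; rw [h']
        · right; left; rw [h']
        · right; right; rw [h']
    have hp := h.shift (i := i) (by omega)
    have hki : 2 * i + 2 * (k - i) = 2 * k := by omega
    have huniq : ∀ a b, a ∈ ({0, 1} : Finset ℕ) → b ∈ ({0, 1} : Finset ℕ) → v (2 * i + a) ∈ f →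
        v (2 * i + b) ∈ f → a = b := by
      intro a b ha hb haf hbf
      by_contra hab
      simp only [mem_insert, mem_singleton] at ha hb
      refine hfi (hlin.eq hf (h.mem _ (by omega)) (fun h' => hab ?_) haf hbf ?_ ?_)
      · have := h.inj _ (by omega) _ (by omega) h'
        omega
      · rw [mem_block]; rcases ha with rfl | rfl <;> simp
      · rw [mem_block]; rcases hb with rfl | rfl <;> simp
    have hcases : v (2 * i) ∈ f ∨ v (2 * i + 1) ∈ f := by
      rcases mem_block.1 hw.2 with rfl | rfl | rfl
      · exact Or.inl hw.1
      · exact Or.inr hw.1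
      · have := hrest _ le_rfl (by omega) hw.1
        omega
    -- If `f` meets block `i` in its middle vertex, the first two vertices of the shifted path are
    -- swapped.
    rcases hcases with hv | hv
    · refine hp.exists_cycleSeq_of_ends (by omega) hf (h3 f hf) (by simpa using hv)
        (by simpa [hki] using hfv) fun a ha haf => ?_
      by_cases ha2 : 2 ≤ a
      · have := hrest _ (by omega) (by omega) haf
        omega
      · have := huniq a 0 (by simp; omega) (by simp) haf (by simpa using hv)
        exact Or.inl this
    · have hs : ∀ a, 1 < a → Equiv.swap 0 1 a = a := fun a ha =>
        Equiv.swap_apply_of_ne_of_ne (by omega) (by omega)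
      refine (hp.swap_first (by omega)).exists_cycleSeq_of_ends (by omega) hf (h3 f hf)
        (by simpa using hv) ?_ fun a ha haf => ?_
      · simpa [hs (2 * (k - i)) (by omega), hki] using hfv
      by_cases ha2 : 2 ≤ a
      · simp only [Function.comp, hs a ha2] at haf
        have := hrest _ (by omega) (by omega) haf
        omega
      · obtain rfl | rfl : a = 0 ∨ a = 1 := by omega
        · exact Or.inl rfl
        · have := huniq 0 1 (by simp) (by simp) (by simpa using haf) hv
          omega
  · left
    push Not at hJ
    have hnot : ∀ a < 2 * k, v a ∉ f := by
      intro a ha haf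
      by_cases hak : a < 2 * k - 2
      · have : v a ∈ f ∩ block v (a / 2) := by
          rw [mem_inter, mem_block]
          refine ⟨haf, ?_⟩
          rcases Nat.even_or_odd' a with ⟨c, rfl | rfl⟩
          · left; congr 1; omega
          · right; left; congr 1; omega
        rw [hJ (a / 2) (by omega)] at this
        simp at this
      · have := h.inj _ (by omega) _ (by omega) (hf1 (v a) ?_ haf)
        · omega
        · rw [mem_block]
          obtain h' | h' : a = 2 * (k - 1) ∨ a = 2 * (k - 1) + 1 := by omega
          · left; rw [h']
          · right; left; rw [h']
    obtain ⟨s, t, hst, hft⟩ := card_eq_two.1 (show (f.erase (v (2 * k))).card = 2 by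
      rw [card_erase_of_mem hfv, h3 f hf])
    have hs : s ∈ f.erase (v (2 * k)) := by simp [hft]
    have ht : t ∈ f.erase (v (2 * k)) := by simp [hft]
    rw [mem_erase] at hs ht
    have hsv : ∀ a ≤ 2 * k, v a ≠ s := fun a ha has => by
      rcases ha.lt_or_eq with ha | rfl
      · exact hnot a ha (has ▸ hs.2)
      · exact hs.1 has.symm
    have htv : ∀ a ≤ 2 * k, v a ≠ t := fun a ha has => by
      rcases ha.lt_or_eq with ha | rfl
      · exact hnot a ha (has ▸ ht.2)
      · exact ht.1 has.symm
    have hfst : f = {v (2 * k), s, t} := by rw [← hft, insert_erase hfv]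
    refine ⟨fun a => if a ≤ 2 * k then v a else if a = 2 * k + 1 then s else t, ?_, ?_⟩
    · intro a ha b hb hab
      split_ifs at hab with c1 c2 c3 c4 c5 c6 c7 c8
      · exact h.inj _ c1 _ c2 hab
      · exact absurd hab (hsv a c1)
      · exact absurd hab (htv a c1)
      · exact absurd hab.symm (hsv b c5)
      · omega
      · exact absurd hab hst
      · exact absurd hab.symm (htv b c7)
      · exact absurd hab.symm hst
      · omega
    · intro i hi
      rcases Nat.lt_or_ge i k with hik | hik
      · have := h.mem i hik
        simpa [block, show 2 * i ≤ 2 * k by omega, show 2 * i + 1 ≤ 2 * k by omega,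
          show 2 * i + 2 ≤ 2 * k by omega] using this
      · obtain rfl : i = k := by omega
        rw [hfst] at hf
        simpa [block, show ¬ 2 * i + 1 ≤ 2 * i by omega, show ¬ 2 * i + 2 ≤ 2 * i by omega] using hf

end IsPathSeq

/-- A reduced nonempty linear family of edges of size 3 contains a cycle. -/
theorem exists_cycleSeq (hlin : Linear E) (h3 : ∀ e ∈ E, e.card = 3) (hred : Reduced E)
    (hne : E.Nonempty) : ∃ v l, IsCycleSeq v l ∧ ∀ i < l, block v i ∈ E := by
  by_contra hcon
  -- Without a cycle every path can be prolonged, which is impossible in a finite family. A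
  -- prolonging edge exists since in the last block, by reducedness, one of the last two vertices
  -- lies in another edge.
  have key : ∀ k, ∃ v, IsPathSeq E v (k + 1) := by
    intro k
    induction k with
    | zero =>
      obtain ⟨e, he⟩ := hne
      obtain ⟨a, b, c, hab, hac, hbc, rfl⟩ := card_eq_three.1 (h3 e he)
      refine ⟨fun i => if i = 0 then a else if i = 1 then b else c, ?_, ?_⟩
      · intro i hi j hj hij
        split_ifs at hij <;>
          first
            | omega
            | exact absurd hij ‹_›
            | exact absurd hij.symm ‹_›
      · intro i hi
        obtain rfl : i = 0 := by omega
        simpa [block] using he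
    | succ k ih =>
      obtain ⟨v, h⟩ := ih
      have hmem : ∀ a, a = 2 * (k + 1) - 1 ∨ a = 2 * (k + 1) → v a ∈ block v k := by
        rintro a (rfl | rfl)
        · exact mem_block.2 (Or.inr (Or.inl rfl))
        · exact mem_block.2 (Or.inr (Or.inr rfl))
      have hex : ∃ a, (a = 2 * (k + 1) - 1 ∨ a = 2 * (k + 1)) ∧ ∃ f ∈ E, v a ∈ f ∧ f ≠ block v k := by
        by_contra! hno
        have hb := h.mem k (by omega)
        have := hred _ hb (h3 _ hb) _ (hmem _ (Or.inl rfl)) _ (hmem _ (Or.inr rfl))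
          (fun f hf hvf => hno _ (Or.inl rfl) f hf hvf) (fun f hf hvf => hno _ (Or.inr rfl) f hf hvf)
        have := h.inj _ (by omega) _ (by omega) this
        omega
      obtain ⟨a, ha, f, hf, haf, hfb⟩ := hex
      rcases ha with rfl | rfl
      · have h' := h.swap_last (by omega)
        have hbl : block (v ∘ Equiv.swap (2 * (k + 1) - 1) (2 * (k + 1))) k = block v k := by
          have e1 : 2 * k + 1 = 2 * (k + 1) - 1 := by omega
          have e2 : 2 * k + 2 = 2 * (k + 1) := by omega
          simp only [block, Function.comp, e1, e2, Equiv.swap_apply_left, Equiv.swap_apply_right]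
          rw [Equiv.swap_apply_of_ne_of_ne (by omega) (by omega), pair_comm]
        refine (h'.extend_or_cycle hlin h3 (by omega) hf ?_ ?_).resolve_right hcon
        · simpa using haf
        · rw [Nat.add_sub_cancel, hbl]; exact hfb
      · exact (h.extend_or_cycle hlin h3 (by omega) hf haf (by simpa using hfb)).resolve_right hcon
  obtain ⟨v, h⟩ := key (E.biUnion id).card
  have hsub : (range (2 * (E.biUnion id).card)).image v ⊆ E.biUnion id := by
    intro w hw
    obtain ⟨a, ha, rfl⟩ := mem_image.1 hw
    rw [mem_range] at ha
    rw [mem_biUnion]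
    refine ⟨_, h.mem (a / 2) (by omega), ?_⟩
    rw [id, mem_block]
    rcases Nat.even_or_odd' a with ⟨c, rfl | rfl⟩
    · left; congr 1; omega
    · right; left; congr 1; omega
  have hcard := card_le_card hsub
  rw [card_image_of_injOn, card_range] at hcard
  · obtain ⟨e, he⟩ := hne
    have : 0 < (E.biUnion id).card := by
      obtain ⟨x, hx⟩ := card_pos.1 (show 0 < e.card by rw [h3 e he]; omega)
      exact card_pos.2 ⟨x, mem_biUnion.2 ⟨e, he, hx⟩⟩
    omega
  · intro a ha b hb hab
    rw [mem_coe, mem_range] at ha hb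
    exact h.inj _ (by omega) _ (by omega) hab

end AvoiderEnforcer

/-! ### Cycles, and the shape of connected winning families. -/

namespace AvoiderEnforcer

open Finset

variable {α : Type*} [DecidableEq α]

variable {E : Finset (Finset α)} {R : Finset α} {v : ℕ → α} {l : ℕ}

/-- The vertices of a cycle. -/
def cycleVertices (v : ℕ → α) (l : ℕ) : Finset α := (range (2 * l)).image v

/-- The edges of a cycle. -/
def cycleEdges (v : ℕ → α) (l : ℕ) : Finset (Finset α) := (range l).image (block v)

theorem mem_cycleVertices {w : α} : w ∈ cycleVertices v l ↔ ∃ a < 2 * l, v a = w := by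
  simp [cycleVertices]

theorem mem_cycleEdges {e : Finset α} : e ∈ cycleEdges v l ↔ ∃ i < l, block v i = e := by
  simp [cycleEdges]

namespace IsCycleSeq

/-- The last alternative is the wrap-around: the final block ends at `v (2 * l) = v 0`. -/
theorem mem_block_iff (h : IsCycleSeq v l) {a i : ℕ} (ha : a < 2 * l) (hi : i < l) :
    v a ∈ block v i ↔ a = 2 * i ∨ a = 2 * i + 1 ∨ a = 2 * i + 2 ∨ (a = 0 ∧ i + 1 = l) := by
  rw [mem_block]
  constructor
  · rintro (h' | h' | h')
    · exact Or.inl (h.inj _ ha _ (by omega) h')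
    · exact Or.inr (Or.inl (h.inj _ ha _ (by omega) h'))
    · by_cases hil : i + 1 = l
      · rw [show 2 * i + 2 = 2 * l by omega, h.closed] at h'
        exact Or.inr (Or.inr (Or.inr ⟨h.inj _ ha _ (by omega) h', hil⟩))
      · exact Or.inr (Or.inr (Or.inl (h.inj _ ha _ (by omega) h')))
  · rintro (rfl | rfl | rfl | ⟨rfl, hil⟩)
    · exact Or.inl rfl
    · exact Or.inr (Or.inl rfl)
    · exact Or.inr (Or.inr rfl)
    · rw [show 2 * i + 2 = 2 * l by omega, h.closed]
      exact Or.inr (Or.inr rfl)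

theorem card_cycleVertices (h : IsCycleSeq v l) : (cycleVertices v l).card = 2 * l := by
  rw [cycleVertices, card_image_of_injOn, card_range]
  intro a ha b hb hab
  rw [mem_coe, mem_range] at ha hb
  exact h.inj _ ha _ hb hab

theorem block_inj (h : IsCycleSeq v l) {i j : ℕ} (hi : i < l) (hj : j < l)
    (hij : block v i = block v j) : i = j := by
  have : v (2 * i + 1) ∈ block v j := hij ▸ (h.mem_block_iff (by omega) hi).2 (by simp)
  have := (h.mem_block_iff (by omega) hj).1 this
  omega

theorem card_cycleEdges (h : IsCycleSeq v l) : (cycleEdges v l).card = l := by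
  rw [cycleEdges, card_image_of_injOn, card_range]
  intro a ha b hb hab
  rw [mem_coe, mem_range] at ha hb
  exact h.block_inj ha hb hab

theorem block_subset (h : IsCycleSeq v l) {i : ℕ} (hi : i < l) :
    block v i ⊆ cycleVertices v l := by
  intro w hw
  rw [mem_cycleVertices]
  rcases mem_block.1 hw with rfl | rfl | rfl
  · exact ⟨_, by omega, rfl⟩
  · exact ⟨_, by omega, rfl⟩
  · by_cases hil : i + 1 = l
    · exact ⟨0, by omega, by rw [show 2 * i + 2 = 2 * l by omega, h.closed]⟩
    · exact ⟨_, by omega, rfl⟩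

theorem card_block (h : IsCycleSeq v l) {i : ℕ} (hi : i < l) : (block v i).card = 3 := by
  have h3 := h.three_le
  have h1 : v (2 * i) ≠ v (2 * i + 1) := fun h' => by
    have := h.inj _ (by omega) _ (by omega) h'
    omega
  have h2 : v (2 * i + 2) ≠ v (2 * i) ∧ v (2 * i + 2) ≠ v (2 * i + 1) := by
    by_cases hil : i + 1 = l
    · rw [show 2 * i + 2 = 2 * l by omega, h.closed]
      constructor <;> intro h' <;>
      · have := h.inj _ (by omega) _ (by omega) h'
        omega
    · constructor <;> intro h' <;>
      · have := h.inj _ (by omega) _ (by omega) h'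
        omega
  exact card_eq_three.2 ⟨_, _, _, h1, h2.1.symm, h2.2.symm, rfl⟩

theorem next_mem (h : IsCycleSeq v l) {S : Finset α} {i : ℕ} (hS : block v i ⊆ S) :
    (i + 1 < l → (block v (i + 1) ∩ S).Nonempty) ∧ (i + 1 = l → (block v 0 ∩ S).Nonempty) := by
  have hm : v (2 * i + 2) ∈ S := hS (mem_block.2 (by simp))
  refine ⟨fun _ => ⟨v (2 * i + 2), ?_⟩, fun hil => ⟨v (2 * i + 2), ?_⟩⟩
  · rw [mem_inter, mem_block]
    exact ⟨Or.inl (by congr 1), hm⟩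
  · rw [mem_inter, mem_block]
    refine ⟨Or.inl ?_, hm⟩
    rw [show 2 * i + 2 = 2 * l by omega, h.closed]

theorem prev_mem (h : IsCycleSeq v l) {S : Finset α} {i : ℕ} (hS : block v i ⊆ S) :
    (∀ j, j + 1 = i → (block v j ∩ S).Nonempty) ∧
      (i = 0 → ∀ j, j + 1 = l → (block v j ∩ S).Nonempty) := by
  have hm : v (2 * i) ∈ S := hS (mem_block.2 (by simp))
  refine ⟨fun j hj => ⟨v (2 * i), ?_⟩, fun hi j hj => ⟨v (2 * i), ?_⟩⟩
  · rw [mem_inter, mem_block]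
    exact ⟨Or.inr (Or.inr (by congr 1; omega)), hm⟩
  · rw [mem_inter, mem_block]
    refine ⟨Or.inr (Or.inr ?_), hm⟩
    rw [show 2 * j + 2 = 2 * l by omega, h.closed, hi, mul_zero]

/-- A cycle stays connected after removal of at most one edge. -/
theorem block_subset_of_closed (h : IsCycleSeq v l) {S : Finset α} (j : ℕ)
    (hS : ∀ i < l, i ≠ j → (block v i ∩ S).Nonempty → block v i ⊆ S) {i₀ : ℕ} (hi₀ : i₀ < l)
    (hij : i₀ ≠ j) (hi₀S : block v i₀ ⊆ S) : ∀ i < l, i ≠ j → block v i ⊆ S := by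
  have h3 := h.three_le
  have up : ∀ i < l, i ≠ j → block v i ⊆ S → ∀ d, i + d < l → (∀ c, i ≤ c → c ≤ i + d → c ≠ j) →
      block v (i + d) ⊆ S := by
    intro i hi hne hiS d
    induction d with
    | zero => exact fun _ _ => hiS
    | succ d ih =>
      intro hd hc
      have := ih (by omega) fun c h1 h2 => hc c h1 (by omega)
      exact hS _ hd (hc _ (by omega) le_rfl) ((h.next_mem this).1 hd)
  have down : ∀ d i, i + d < l → block v (i + d) ⊆ S → (∀ c, i ≤ c → c ≤ i + d → c ≠ j) →
      block v i ⊆ S := by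
    intro d
    induction d with
    | zero => exact fun i _ hiS _ => hiS
    | succ d ih =>
      intro i hd hiS hc
      refine hS i (by omega) (hc i le_rfl (by omega)) ((h.prev_mem (ih (i + 1) (by omega) ?_
        fun c h1 h2 => hc c (by omega) (by omega))).1 i rfl)
      rwa [show i + 1 + d = i + (d + 1) by omega]
  have up' : ∀ i i', i ≤ i' → i' < l → block v i ⊆ S → (∀ c, i ≤ c → c ≤ i' → c ≠ j) →
      block v i' ⊆ S := by
    intro i i' hii hi' hiS hc
    obtain ⟨d, rfl⟩ := Nat.exists_eq_add_of_le hii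
    exact up i (by omega) (hc i le_rfl hii) hiS d hi' hc
  have down' : ∀ i i', i ≤ i' → i' < l → block v i' ⊆ S → (∀ c, i ≤ c → c ≤ i' → c ≠ j) →
      block v i ⊆ S := by
    intro i i' hii hi' hiS hc
    obtain ⟨d, rfl⟩ := Nat.exists_eq_add_of_le hii
    exact down d i hi' hiS hc
  intro i hi hne
  -- If `j` separates `i₀` from `i`, go around the other way, through the junction of the blocks `l
  -- - 1` and `0`.
  rcases Nat.lt_or_gt_of_ne hij with h1 | h1 <;> rcases Nat.lt_or_gt_of_ne hne with h2 | h2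
  · rcases le_total i₀ i with h' | h'
    · exact up' _ _ h' hi hi₀S fun c _ _ => by omega
    · exact down' _ _ h' hi₀ hi₀S fun c _ _ => by omega
  · have h0 : block v 0 ⊆ S := down' _ _ (Nat.zero_le _) hi₀ hi₀S fun c _ _ => by omega
    have hl : block v (l - 1) ⊆ S := hS _ (by omega) (by omega)
      ((h.prev_mem h0).2 rfl _ (by omega))
    exact down' _ _ (by omega) (by omega) hl fun c _ _ => by omega
  · have hl : block v (l - 1) ⊆ S := up' _ _ (by omega) (by omega) hi₀S fun c _ _ => by omega
    have h0 : block v 0 ⊆ S := hS _ (by omega) (by omega)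
      ((h.next_mem hl).2 (by omega))
    exact up' _ _ (Nat.zero_le _) (by omega) h0 fun c _ _ => by omega
  · rcases le_total i₀ i with h' | h'
    · exact up' _ _ h' hi hi₀S fun c _ _ => by omega
    · exact down' _ _ h' hi₀ hi₀S fun c _ _ => by omega

/-- Every vertex of a cycle, except possibly the vertex of degree 1 of a given edge, belongs to
another edge. -/
theorem exists_block (h : IsCycleSeq v l) (j : ℕ) {a : ℕ} (ha : a < 2 * l) (haj : a ≠ 2 * j + 1) :
    ∃ i < l, i ≠ j ∧ v a ∈ block v i := by
  have h3 := h.three_le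
  by_cases hj : a = 2 * j
  · rcases Nat.eq_zero_or_pos j with rfl | hj0
    · exact ⟨l - 1, by omega, by omega, (h.mem_block_iff ha (by omega)).2 (by omega)⟩
    · exact ⟨j - 1, by omega, by omega, (h.mem_block_iff ha (by omega)).2 (by omega)⟩
  · exact ⟨a / 2, by omega, by omega, (h.mem_block_iff ha (by omega)).2 (by omega)⟩

theorem connects_of_ne (h : IsCycleSeq v l) {F : Finset (Finset α)} {W : Finset α} (j : ℕ)
    (hW : ∀ w, w ∈ W ↔ ∃ a < 2 * l, a ≠ 2 * j + 1 ∧ v a = w)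
    (hF : ∀ i < l, i ≠ j → block v i ∈ F) : Connects F W := by
  intro S hSW hSne hcl
  obtain ⟨s, hs⟩ := hSne
  obtain ⟨a, ha, haj, rfl⟩ := (hW s).1 (hSW hs)
  obtain ⟨i₀, hi₀, hij, hai⟩ := h.exists_block j ha haj
  have hcl' : ∀ i < l, i ≠ j → (block v i ∩ S).Nonempty → block v i ⊆ S :=
    fun i hi hij => hcl _ (hF i hi hij)
  have hall := h.block_subset_of_closed j hcl' hi₀ hij
    (hcl' i₀ hi₀ hij ⟨v a, by simp [hai, hs]⟩)
  refine hSW.antisymm fun w hw => ?_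
  obtain ⟨b, hb, hbj, rfl⟩ := (hW w).1 hw
  obtain ⟨i, hi, hij, hbi⟩ := h.exists_block j hb hbj
  exact hall i hi hij hbi

theorem connects (h : IsCycleSeq v l) : Connects (cycleEdges v l) (cycleVertices v l) := by
  -- The index `l` belongs to no block of the cycle, so nothing is removed.
  refine h.connects_of_ne l (fun w => ?_) fun i hi _ => mem_cycleEdges.2 ⟨i, hi, rfl⟩
  rw [mem_cycleVertices]
  exact exists_congr fun a => ⟨fun ⟨h1, h2⟩ => ⟨h1, by omega, h2⟩, fun ⟨h1, _, h2⟩ => ⟨h1, h2⟩⟩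

/-- If Avoider wins as last player, then an additional edge spanned by the vertices of a cycle
contains all the vertices of degree 1 of this cycle. -/
theorem midpoint_mem (h : IsCycleSeq v l) (hlin : Linear E) (hcard : ∀ e ∈ E, e.card ≤ 3)
    (hE : ∀ i < l, block v i ∈ E) (hw : Wins E ∅ (cycleVertices v l)) {e : Finset α} (he : e ∈ E)
    (hne : e ∉ cycleEdges v l) (heV : e ⊆ cycleVertices v l) {j : ℕ} (hj : j < l) :
    v (2 * j + 1) ∈ e := by
  have h3 := h.three_le
  by_contra hcon
  -- Exchange block `j` for `e` and drop the middle vertex of block `j`: a connected family with `2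
  -- * l - 1` vertices and `l` edges, whereas a tree would have `2 * l + 1` vertices.
  set W := (cycleVertices v l).erase (v (2 * j + 1)) with hWdef
  have hmid : v (2 * j + 1) ∈ cycleVertices v l := mem_cycleVertices.2 ⟨_, by omega, rfl⟩
  have hW : ∀ w, w ∈ W ↔ ∃ a < 2 * l, a ≠ 2 * j + 1 ∧ v a = w := by
    intro w
    rw [hWdef, mem_erase, mem_cycleVertices]
    constructor
    · rintro ⟨hwj, a, ha, rfl⟩
      exact ⟨a, ha, fun h' => hwj (by rw [h']), rfl⟩
    · rintro ⟨a, ha, haj, rfl⟩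
      exact ⟨fun h' => haj (h.inj _ ha _ (by omega) h'), a, ha, rfl⟩
  have hWcard : W.card = 2 * l - 1 := by
    rw [hWdef, card_erase_of_mem hmid, h.card_cycleVertices]
  set C := insert e ((cycleEdges v l).erase (block v j)) with hC
  have hCE : C ⊆ E := by
    refine insert_subset he ((erase_subset _ _).trans fun f hf => ?_)
    obtain ⟨i, hi, rfl⟩ := mem_cycleEdges.1 hf
    exact hE i hi
  have hCcard : C.card = l := by
    rw [hC, card_insert_of_notMem (fun h' => hne (mem_of_mem_erase h')),
      card_erase_of_mem (mem_cycleEdges.2 ⟨j, hj, rfl⟩), h.card_cycleEdges]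
    omega
  have hCW : ∀ f ∈ C, f ⊆ W := by
    intro f hf
    rcases mem_insert.1 hf with rfl | hf
    · exact subset_erase.2 ⟨heV, hcon⟩
    · obtain ⟨hfj, hf⟩ := mem_erase.1 hf
      obtain ⟨i, hi, rfl⟩ := mem_cycleEdges.1 hf
      refine subset_erase.2 ⟨h.block_subset hi, fun hm => ?_⟩
      have hij : i ≠ j := fun h' => hfj (by rw [h'])
      have := (h.mem_block_iff (by omega) hi).1 hm
      omega
  have hconn : Connects C W := h.connects_of_ne j hW fun i hi hij =>
    mem_insert_of_mem (mem_erase.2 ⟨fun h' => hij (h.block_inj hi hj h'),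
      mem_cycleEdges.2 ⟨i, hi, rfl⟩⟩)
  have := (card_vertices_of_odd (hlin.subset hCE) (fun f hf => hcard f (hCE hf)) hCW hconn
    (by rw [hWcard]; exact ⟨l - 1, by omega⟩)
    ((hw.edges hCE).subset (erase_subset _ _))).2
  omega

end IsCycleSeq

/-- The structure of connected reduced linear families on which Avoider wins as last player. -/
theorem structure_of_wins (hlin : Linear E) (hcard : ∀ e ∈ E, e.card ≤ 3)
    (hred : Reduced E) (hER : ∀ e ∈ E, e ⊆ R) (hw : Wins E ∅ R) (hconn : Connects E R) :
    E = ∅ ∨ (∃ e, e.card = 2 ∧ R = e ∧ E = {e}) ∨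
      ∃ v l, IsCycleSeq v l ∧ R = cycleVertices v l ∧ (E = cycleEdges v l ∨
        (l = 3 ∧ E = insert {v 1, v 3, v 5} (cycleEdges v l))) := by
  have h2 : ∀ e ∈ E, 2 ≤ e.card := fun e he => hw.two_le_card he (hER e he)
  rcases E.eq_empty_or_nonempty with h0 | hne
  · exact Or.inl h0
  right
  by_cases hex : ∃ e ∈ E, e.card = 2
  · left
    obtain ⟨e, he, he2⟩ := hex
    have hcl : ∀ f ∈ E, (f ∩ e).Nonempty → f ⊆ e := fun f hf hfe => by
      -- A 2-edge alone is balanced: two vertices, one edge.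
      refine subset_of_inter_nonempty (T₀ := {e}) hlin hcard hred hER hw (by simpa using he)
        (hER e he) (by simp) ?_ (by simp [he2]) hf hfe
      intro S hS hSne hScl
      refine hS.antisymm (hScl e (by simp) ?_)
      rwa [inter_eq_right.2 hS]
    have hR : e = R := hconn e (hER e he) (card_pos.1 (by omega)) hcl
    refine ⟨e, he2, hR.symm, eq_singleton_iff_unique_mem.2 ⟨he, fun f hf => ?_⟩⟩
    refine eq_of_subset_of_card_le (hR ▸ hER f hf) ?_
    have := h2 f hf
    omega
  · right
    have h3 : ∀ e ∈ E, e.card = 3 := fun e he => by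
      have := hcard e he
      have := h2 e he
      have : e.card ≠ 2 := fun h => hex ⟨e, he, h⟩
      omega
    obtain ⟨v, l, h, hE⟩ := exists_cycleSeq hlin h3 hred hne
    have hl := h.three_le
    have hZE : cycleEdges v l ⊆ E := fun f hf => by
      obtain ⟨i, hi, rfl⟩ := mem_cycleEdges.1 hf
      exact hE i hi
    have hZV : ∀ f ∈ cycleEdges v l, f ⊆ cycleVertices v l := fun f hf => by
      obtain ⟨i, hi, rfl⟩ := mem_cycleEdges.1 hf
      exact h.block_subset hi
    have hVR : cycleVertices v l ⊆ R := fun w hw' => by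
      obtain ⟨a, ha, rfl⟩ := mem_cycleVertices.1 hw'
      obtain ⟨i, hi, -, hai⟩ := h.exists_block l ha (by omega)
      exact hER _ (hE i hi) hai
    have hR : cycleVertices v l = R :=
      hconn _ hVR ⟨v 0, mem_cycleVertices.2 ⟨0, by omega, rfl⟩⟩ fun f hf hfV =>
        subset_of_inter_nonempty hlin hcard hred hER hw hZE hVR hZV h.connects
          (by rw [h.card_cycleVertices, h.card_cycleEdges]) hf hfV
    refine ⟨v, l, h, hR.symm, ?_⟩
    by_cases hextra : ∃ e ∈ E, e ∉ cycleEdges v l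
    · right
      have hmid : ∀ e ∈ E, e ∉ cycleEdges v l → ∀ j < l, v (2 * j + 1) ∈ e := fun e he hne j hj =>
        h.midpoint_mem hlin hcard hE (hR ▸ hw) he hne (hR ▸ hER e he) hj
      obtain ⟨e, he, hne⟩ := hextra
      -- All `l ≥ 3` middle vertices lie in one edge of size 3.
      have hl3 : l = 3 := by
        have hsub : (range l).image (fun j => v (2 * j + 1)) ⊆ e := fun w hw' => by
          obtain ⟨j, hj, rfl⟩ := mem_image.1 hw'
          exact hmid e he hne j (mem_range.1 hj)
        have := card_le_card hsub
        rw [card_image_of_injOn, card_range, h3 e he] at this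
        · omega
        · intro a ha b hb hab
          rw [mem_coe, mem_range] at ha hb
          have := h.inj _ (by omega) _ (by omega) hab
          omega
      refine ⟨hl3, ?_⟩
      have h135 : ({v 1, v 3, v 5} : Finset α).card = 3 :=
        card_eq_three.2 ⟨_, _, _, fun h' => by simpa using h.inj _ (by omega) _ (by omega) h',
          fun h' => by simpa using h.inj _ (by omega) _ (by omega) h',
          fun h' => by simpa using h.inj _ (by omega) _ (by omega) h', rfl⟩
      have hall : ∀ f ∈ E, f ∉ cycleEdges v l → f = {v 1, v 3, v 5} := fun f hf hfn => by
        refine (eq_of_subset_of_card_le ?_ (by rw [h3 f hf, h135])).symm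
        simp only [insert_subset_iff, singleton_subset_iff]
        exact ⟨hmid f hf hfn 0 (by omega), hmid f hf hfn 1 (by omega), hmid f hf hfn 2 (by omega)⟩
      refine Subset.antisymm (fun f hf => ?_) (insert_subset (hall e he hne ▸ he) hZE)
      by_cases hfn : f ∈ cycleEdges v l
      · exact mem_insert_of_mem hfn
      · exact mem_insert.2 (Or.inl (hall f hf hfn))
    · left
      push Not at hextra
      exact Subset.antisymm hextra hZE

end AvoiderEnforcer

/-! ### Avoider's strategies on cycles, prisms and 2-edges. -/

namespace AvoiderEnforcer

open Finset

variable {α : Type*} [DecidableEq α]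

variable {E : Finset (Finset α)} {R : Finset α} {v : ℕ → α} {l : ℕ}

/-- Avoider wins as last player on an even number of vertices if, for every first move `y` of
Enforcer, the edges avoiding `y` can be eliminated one by one. -/
theorem wins_of_private_pairs_of_even (heven : Even R.card) (hne : R.Nonempty)
    (hE : ∀ y ∈ R, ∀ F ⊆ E, (∀ f ∈ F, y ∉ f) → F.Nonempty → ∃ e ∈ F, ∃ u ∈ e, ∃ w ∈ e, u ≠ w ∧
      ∀ f ∈ F, f ≠ e → u ∉ f ∧ w ∉ f) : Wins E ∅ R := by
  rw [wins_of_even heven hne]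
  intro y hy
  have h := wins_of_private_pairs (E := {e ∈ E | y ∉ e})
    (fun F hF hF0 => hE y hy F (hF.trans (filter_subset _ _))
      (fun f hf => (mem_filter.1 (hF hf)).2) hF0) (R.erase y)
  refine h.mono Subset.rfl fun f hf hfR => ⟨f, mem_filter.2 ⟨hf, fun hyf => ?_⟩, Subset.rfl⟩
  simpa using hfR hyf

/-- Enforcer's first vertex destroys a block, so among the remaining ones some block has no
successor; its middle and last vertices are then private. -/
theorem IsCycleSeq.wins (h : IsCycleSeq v l) : Wins (cycleEdges v l) ∅ (cycleVertices v l) := by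
  have h3 := h.three_le
  refine wins_of_private_pairs_of_even (by rw [h.card_cycleVertices]; exact even_two_mul l)
    ⟨v 0, mem_cycleVertices.2 ⟨0, by omega, rfl⟩⟩ fun y hy F hF hyF hne => ?_
  obtain ⟨a, ha, rfl⟩ := mem_cycleVertices.1 hy
  have hmiss : ∃ j < l, block v j ∉ F := by
    obtain ⟨j, hj, -, haj⟩ := h.exists_block l ha (by omega)
    exact ⟨j, hj, fun hjF => hyF _ hjF haj⟩
  obtain ⟨i, hi, hiF, hnext, hwrap⟩ : ∃ i < l, block v i ∈ F ∧
      (i + 1 < l → block v (i + 1) ∉ F) ∧ (i + 1 = l → block v 0 ∉ F) := by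
    by_contra! hcon
    obtain ⟨j, hj, hjF⟩ := hmiss
    obtain ⟨e, he⟩ := hne
    obtain ⟨i, hi, rfl⟩ := mem_cycleEdges.1 (hF he)
    have hup : ∀ i d, i + d < l → block v i ∈ F → block v (i + d) ∈ F := by
      intro i d
      induction d with
      | zero => exact fun _ h => h
      | succ d ih =>
        intro hd hiF
        by_contra hno
        have := (hcon _ (by omega) (ih (by omega) hiF) fun _ => hno).1
        omega
    have hlast := hup i (l - 1 - i) (by omega) he
    have h0 : block v 0 ∈ F := (hcon _ (by omega) hlast (by omega)).2
    have := hup 0 j (by omega) h0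
    rw [zero_add] at this
    exact hjF this
  have hmem : ∀ i' < l, v (2 * i + 2) ∈ block v i' → block v i' ∈ F → i' = i := by
    intro i' hi' hm hi'F
    by_cases hil : i + 1 = l
    · rw [show 2 * i + 2 = 2 * l by omega, h.closed, h.mem_block_iff (by omega) hi'] at hm
      obtain h' | h' : i' = 0 ∨ i' = i := by omega
      · exact absurd (h' ▸ hi'F) (hwrap hil)
      · exact h'
    · rw [h.mem_block_iff (by omega) hi'] at hm
      obtain h' | h' : i' = i + 1 ∨ i' = i := by omega
      · exact absurd (h' ▸ hi'F) (hnext (by omega))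
      · exact h'
  have hcard := h.card_block hi
  refine ⟨_, hiF, v (2 * i + 1), mem_block.2 (by simp), v (2 * i + 2), mem_block.2 (by simp),
    fun h' => ?_, fun f hf hfe => ?_⟩
  · have := (card_le_two (a := v (2 * i)) (b := v (2 * i + 2)))
    rw [block, h', pair_eq_singleton] at hcard
    omega
  · obtain ⟨i', hi', rfl⟩ := mem_cycleEdges.1 (hF hf)
    refine ⟨fun hm => hfe ?_, fun hm => hfe ?_⟩
    · have := (h.mem_block_iff (by omega) hi').1 hm
      rw [show i' = i by omega]
    · rw [hmem i' hi' hm hf]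

/-- Every vertex lies in two of the four edges, so at most two survive Enforcer's first move. By
linearity each of them has two vertices outside the other. -/
theorem IsCycleSeq.wins_prism (h : IsCycleSeq v 3)
    (hlin : Linear (insert {v 1, v 3, v 5} (cycleEdges v 3))) :
    Wins (insert {v 1, v 3, v 5} (cycleEdges v 3)) ∅ (cycleVertices v 3) := by
  set m : Finset α := {v 1, v 3, v 5} with hm
  have hmem : ∀ a < 6, v a ∈ m → a = 1 ∨ a = 3 ∨ a = 5 := by
    intro a ha ham
    simp only [hm, mem_insert, mem_singleton] at ham
    rcases ham with h' | h' | h' <;>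
    · have := h.inj _ ha _ (by omega) h'
      omega
  have hmid : m ∉ cycleEdges v 3 := by
    intro hme
    obtain ⟨i, hi, him⟩ := mem_cycleEdges.1 hme
    have := hmem (2 * i) (by omega) (him ▸ mem_block.2 (Or.inl rfl))
    omega
  have hcard : ∀ e ∈ insert m (cycleEdges v 3), e.card = 3 := by
    intro e he
    rcases mem_insert.1 he with rfl | he
    · refine card_eq_three.2 ⟨v 1, v 3, v 5, ?_, ?_, ?_, rfl⟩ <;>
      · intro h'
        have := h.inj _ (by omega) _ (by omega) h'
        omega
    · obtain ⟨i, hi, rfl⟩ := mem_cycleEdges.1 he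
      exact h.card_block hi
  refine wins_of_private_pairs_of_even (by rw [h.card_cycleVertices]; decide)
    ⟨v 0, mem_cycleVertices.2 ⟨0, by omega, rfl⟩⟩ fun y hy F hF hyF hne => ?_
  obtain ⟨a, ha, rfl⟩ := mem_cycleVertices.1 hy
  have htwo : ∃ e ∈ insert m (cycleEdges v 3), ∃ f ∈ insert m (cycleEdges v 3), e ≠ f ∧
      v a ∈ e ∧ v a ∈ f := by
    obtain ⟨i, hi, hi', hai⟩ := h.exists_block 3 ha (by omega)
    have hi3 : block v i ∈ insert m (cycleEdges v 3) :=
      mem_insert_of_mem (mem_cycleEdges.2 ⟨i, hi, rfl⟩)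
    rcases Nat.even_or_odd' a with ⟨c, rfl | rfl⟩
    · obtain ⟨j, hj, hji, haj⟩ := h.exists_block i ha (by omega)
      exact ⟨_, hi3, _, mem_insert_of_mem (mem_cycleEdges.2 ⟨j, hj, rfl⟩),
        fun h' => hji (h.block_inj hi hj h').symm, hai, haj⟩
    · refine ⟨_, hi3, _, mem_insert_self _ _,
        fun h' => hmid (h' ▸ mem_cycleEdges.2 ⟨i, hi, rfl⟩), hai, ?_⟩
      obtain rfl | rfl | rfl : c = 0 ∨ c = 1 ∨ c = 2 := by omega
      all_goals simp [hm]
  obtain ⟨e₁, he₁, e₂, he₂, he12, hae₁, hae₂⟩ := htwo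
  have hF2 : F.card ≤ 2 := by
    have hsub : F ⊆ ((insert m (cycleEdges v 3)).erase e₁).erase e₂ := fun f hf =>
      mem_erase.2 ⟨fun h' => hyF f hf (h' ▸ hae₂),
        mem_erase.2 ⟨fun h' => hyF f hf (h' ▸ hae₁), hF hf⟩⟩
    refine (card_le_card hsub).trans ?_
    rw [card_erase_of_mem (mem_erase.2 ⟨he12.symm, he₂⟩), card_erase_of_mem he₁,
      card_insert_of_notMem hmid, h.card_cycleEdges]
  obtain ⟨e, he⟩ := hne
  obtain ⟨f, hf⟩ : ∃ f, ∀ g ∈ F, g ≠ e → g = f ∧ g ∈ F := by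
    have : (F.erase e).card ≤ 1 := by rw [card_erase_of_mem he]; omega
    rcases (F.erase e).eq_empty_or_nonempty with h0 | ⟨f, hf⟩
    · refine ⟨e, fun g hg hge => ?_⟩
      have : g ∈ F.erase e := mem_erase.2 ⟨hge, hg⟩
      simp [h0] at this
    · exact ⟨f, fun g hg hge => ⟨card_le_one.1 this g (mem_erase.2 ⟨hge, hg⟩) f hf, hg⟩⟩
  have he3 := hcard e (hF he)
  by_cases hfF : f ∈ F ∧ f ≠ e
  · have hi := hlin e (hF he) f (hF hfF.1) hfF.2.symm
    have := card_sdiff_add_card_inter e f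
    obtain ⟨u, hu, w, hw, huw⟩ := one_lt_card.1 (show 1 < (e \ f).card by omega)
    rw [mem_sdiff] at hu hw
    refine ⟨e, he, u, hu.1, w, hw.1, huw, fun g hg hge => ?_⟩
    rw [(hf g hg hge).1]
    exact ⟨hu.2, hw.2⟩
  · obtain ⟨u, hu, w, hw, huw⟩ := one_lt_card.1 (show 1 < e.card by omega)
    refine ⟨e, he, u, hu, w, hw, huw, fun g hg hge => absurd ?_ hfF⟩
    have := (hf g hg hge).1
    exact this ▸ ⟨hg, hge⟩

theorem wins_singleton_edge {e : Finset α} (he : e.card = 2) (R : Finset α) : Wins {e} ∅ R := by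
  refine wins_of_private_pairs (fun F hF hne => ?_) R
  obtain ⟨f, hf⟩ := hne
  obtain ⟨u, hu, w, hw, huw⟩ := one_lt_card.1 (show 1 < e.card by omega)
  have hF' : ∀ f ∈ F, f = e := fun f hf => mem_singleton.1 (hF hf)
  exact ⟨e, hF' f hf ▸ hf, u, hu, w, hw, huw, fun g hg hge => absurd (hF' g hg) hge⟩

end AvoiderEnforcer

/-! ### Cycles as hypergraphs versus closed vertex sequences. -/

namespace Hypergraph

open AvoiderEnforcer

theorem exists_eq_of_encard_eq_three {α : Type*} {s : Set α} (hs : s.encard = 3) {a b : α} (ha : a ∈ s)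
    (hb : b ∈ s) (hab : a ≠ b) : ∃ w, s = {a, w, b} ∧ w ≠ a ∧ w ≠ b := by
  obtain ⟨x, y, z, hxy, hxz, hyz, rfl⟩ := Set.encard_eq_three.1 hs
  rcases ha with rfl | rfl | rfl <;> rcases hb with rfl | rfl | rfl <;>
    first
      | exact absurd rfl hab
      | exact ⟨z, by ext; grind, by tauto, by tauto⟩
      | exact ⟨y, by ext; grind, by tauto, by tauto⟩
      | exact ⟨x, by ext; grind, by tauto, by tauto⟩

variable {α : Type*} [DecidableEq α] {C : Hypergraph α} {v : ℕ → α} {l : ℕ}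

/-- `C` is the cycle with vertices `v 0, …, v (2 * l - 1)`. -/
structure IsCycleOn (C : Hypergraph α) (v : ℕ → α) (l : ℕ) : Prop where
  seq : IsCycleSeq v l
  vertexSet_eq : V(C) = cycleVertices v l
  mem_edgeSet : ∀ e, e ∈ E(C) ↔ ∃ i < l, (block v i : Set α) = e

theorem coe_block (v : ℕ → α) (i : ℕ) :
    (block v i : Set α) = {v (2 * i), v (2 * i + 1), v (2 * i + 2)} := by
  simp [block]

/-- All blocks but the last form the chain; the last one is the closing edge and its middle vertex
is the new vertex. -/
theorem IsCycleOn.isCycleOfLength (h : C.IsCycleOn v l) : C.IsCycleOfLength l := by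
  have h3 := h.seq.three_le
  obtain ⟨n, rfl⟩ : ∃ n, l = n + 2 := ⟨l - 2, by omega⟩
  have hs := h.seq
  let P : Hypergraph α :=
    { vertexSet := ⋃ i : Fin (n + 1), (block v i : Set α)
      edgeSet := Set.range fun i : Fin (n + 1) => (block v i : Set α)
      subset_vertexSet_of_mem_edgeSet' := by
        rintro e ⟨i, rfl⟩
        exact Set.subset_iUnion (fun i : Fin (n + 1) => (block v i : Set α)) i }
  have hV : ∀ a < 2 * (n + 2), (v a ∈ V(P) ↔ a ≠ 2 * (n + 1) + 1) := by
    intro a ha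
    simp only [P, Set.mem_iUnion, Finset.mem_coe]
    constructor
    · rintro ⟨i, hi⟩
      rw [hs.mem_block_iff ha (by omega)] at hi
      omega
    · intro hane
      obtain ⟨i, hi, hin, hai⟩ := hs.exists_block (n + 1) ha hane
      exact ⟨⟨i, by omega⟩, hai⟩
  have hclosing : (block v (n + 1) : Set α) = {v 0, v (2 * (n + 1)), v (2 * (n + 1) + 1)} := by
    have := hs.closed
    rw [coe_block, show 2 * (n + 1) + 2 = 2 * (n + 2) by ring, this]
    ext; simp; tauto
  refine ⟨P, v 0, v (2 * (n + 1)), v (2 * (n + 1) + 1), n, fun i => (block v i : Set α),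
    ?_, by omega, rfl, ?_, ?_, ?_⟩
  · refine ⟨?_, rfl, rfl, ?_, ⟨fun i => ⟨i, rfl⟩, ?_⟩, ?_, ?_, ?_, ?_, ?_⟩
    · intro h'
      have := hs.inj _ (by omega) _ (by omega) h'
      omega
    · intro i j hij
      exact Fin.ext (hs.block_inj (by omega) (by omega) (Finset.coe_injective hij))
    · intro i
      refine ⟨v (2 * i + 2), ?_, ?_⟩
      · simp [mem_block]
      · simp [mem_block, mul_add]
    · intro i j hij
      rw [Finset.disjoint_coe, Finset.disjoint_left]
      intro w hw hw'
      obtain ⟨a, ha, rfl⟩ := mem_cycleVertices.1 (hs.block_subset (by omega) hw)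
      rw [hs.mem_block_iff ha (by omega)] at hw hw'
      omega
    · rintro _ ⟨i, rfl⟩ _ ⟨j, rfl⟩ hne w ⟨hw1, hw2⟩ w' ⟨hw1', hw2'⟩
      simp only [Finset.mem_coe] at hw1 hw2 hw1' hw2'
      have hij : (i : ℕ) ≠ j := fun h' => hne (by simp only [h'])
      obtain ⟨a, ha, rfl⟩ := mem_cycleVertices.1 (hs.block_subset (by omega) hw1)
      obtain ⟨b, hb, rfl⟩ := mem_cycleVertices.1 (hs.block_subset (by omega) hw1')
      rw [hs.mem_block_iff (by omega) (by omega)] at hw1 hw2 hw1' hw2'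
      congr 1
      omega
    · intro i
      rw [Set.encard_coe_eq_coe_finsetCard, hs.card_block (by omega)]
      rfl
    · intro i
      rw [Finset.mem_coe, hs.mem_block_iff (by omega) (by omega), Fin.ext_iff, Fin.val_zero]
      omega
    · intro i
      rw [Finset.mem_coe, hs.mem_block_iff (by omega) (by omega), Fin.ext_iff, Fin.val_last]
      omega
  · rw [hV _ (by omega)]
    simp
  · rw [h.vertexSet_eq]
    ext w
    rw [Finset.mem_coe, mem_cycleVertices, Set.mem_insert_iff]
    constructor
    · rintro ⟨a, ha, rfl⟩
      by_cases hane : a = 2 * (n + 1) + 1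
      · exact Or.inl (by rw [hane])
      · exact Or.inr ((hV a ha).2 hane)
    · rintro (rfl | hw)
      · exact ⟨_, by omega, rfl⟩
      · obtain ⟨i, hi⟩ := Set.mem_iUnion.1 hw
        exact mem_cycleVertices.1 (hs.block_subset (by omega) hi)
  · ext e
    rw [h.mem_edgeSet, Set.mem_insert_iff]
    constructor
    · rintro ⟨i, hi, rfl⟩
      by_cases hin : i = n + 1
      · exact Or.inl (by rw [hin, hclosing])
      · exact Or.inr ⟨⟨i, by omega⟩, rfl⟩
    · rintro (rfl | ⟨i, rfl⟩)
      · exact ⟨n + 1, by omega, hclosing⟩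
      · exact ⟨i, by omega, rfl⟩

/-- Interleave the junctions `p i`, which lie in exactly the chain edges `i - 1` and `i` as far as
these exist, with the third vertices `m i` of the edges. -/
theorem IsCycleOfLength.exists_isCycleOn (h : C.IsCycleOfLength l) : ∃ v, C.IsCycleOn v l := by
  obtain ⟨P, a, b, c, n, e, hP, hn, rfl, hc, hV, hE⟩ := h
  have hp : ∀ i : ℕ, ∃ x, i ≤ n + 1 → (∀ j : Fin (n + 1), x ∈ e j ↔ (j : ℕ) = i ∨ (j : ℕ) + 1 = i) ∧
      (i = 0 → x = a) ∧ (i = n + 1 → x = b) := by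
    intro i
    by_cases h0 : i = 0
    · refine ⟨a, fun _ => ⟨fun j => ?_, fun _ => rfl, by omega⟩⟩
      rw [hP.left, Fin.ext_iff, Fin.val_zero]
      omega
    by_cases hn1 : i = n + 1
    · refine ⟨b, fun _ => ⟨fun j => ?_, by omega, fun _ => rfl⟩⟩
      rw [hP.right, Fin.ext_iff, Fin.val_last]
      omega
    by_cases hi : i ≤ n
    · obtain ⟨x, hx1, hx2⟩ := hP.walk.2 ⟨i - 1, by omega⟩
      refine ⟨x, fun _ => ⟨fun j => ⟨fun hxj => ?_, ?_⟩, by omega, by omega⟩⟩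
      · by_contra hcon
        rcases Nat.lt_or_ge i j with hij | hij
        · exact Set.disjoint_left.1 (hP.simple _ j (by simp; omega)) hx1 hxj
        · exact Set.disjoint_left.1 (hP.simple j _ (by simp; omega)) hxj hx2
      · rintro (hj | hj)
        · convert hx2 using 2
          rw [Fin.ext_iff]; simp; omega
        · convert hx1 using 2
          rw [Fin.ext_iff]; simp; omega
    · exact ⟨a, by omega⟩
  choose p hp using hp
  have hpmem : ∀ i ≤ n + 1, ∀ j : Fin (n + 1), p i ∈ e j ↔ (j : ℕ) = i ∨ (j : ℕ) + 1 = i :=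
    fun i hi => (hp i hi).1
  have hpinj : ∀ i ≤ n + 1, ∀ i' ≤ n + 1, p i = p i' → i = i' := by
    have : ∀ i i', i < i' → i' ≤ n + 1 → p i ≠ p i' := by
      intro i i' hii hi' h'
      -- For `i = 0` the equality forces `i' = 1`, and then the second edge of the chain, present
      -- because there are at least two, tells `p 0` and `p 1` apart.
      by_cases h0 : i = 0
      · have := (hpmem i' hi' ⟨0, by omega⟩).1 (h' ▸ (hpmem i (by omega) ⟨0, by omega⟩).2 (by simp; omega))
        have h2 := (hpmem i (by omega) ⟨i' - 1, by omega⟩).1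
          (h' ▸ (hpmem i' hi' ⟨i' - 1, by omega⟩).2 (by simp; omega))
        simp at this h2
        have h3 := (hpmem i (by omega) ⟨1, by omega⟩)
        rw [h', hpmem i' hi' ⟨1, by omega⟩] at h3
        simp at h3
        omega
      · have := (hpmem i' hi' ⟨i - 1, by omega⟩).1
          (h' ▸ (hpmem i (by omega) ⟨i - 1, by omega⟩).2 (by simp; omega))
        simp at this
        omega
    intro i hi i' hi' h'
    by_contra hne
    rcases Nat.lt_or_gt_of_ne hne with h1 | h1
    · exact this i i' h1 hi' h'
    · exact this i' i h1 hi h'.symm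
  have hm : ∀ i : ℕ, ∃ x, ∀ hi : i < n + 1,
      e ⟨i, hi⟩ = {p i, x, p (i + 1)} ∧ x ≠ p i ∧ x ≠ p (i + 1) := by
    intro i
    by_cases hi : i < n + 1
    · have hsz := hP.size ⟨i, hi⟩
      have h1 : p i ∈ e ⟨i, hi⟩ := (hpmem i (by omega) _).2 (by simp)
      have h2 : p (i + 1) ∈ e ⟨i, hi⟩ := (hpmem (i + 1) (by omega) _).2 (by simp)
      have hne : p i ≠ p (i + 1) := fun h' => by
        have := hpinj i (by omega) (i + 1) (by omega) h'
        omega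
      obtain ⟨w, hw⟩ := exists_eq_of_encard_eq_three hsz h1 h2 hne
      exact ⟨w, fun _ => hw⟩
    · exact ⟨a, fun h => absurd h hi⟩
  choose m hm using hm
  have hmmem : ∀ i (hi : i < n + 1) (j : Fin (n + 1)), m i ∈ e j ↔ (j : ℕ) = i := by
    intro i hi j
    obtain ⟨he, hmi, hmi'⟩ := hm i hi
    have hmem : m i ∈ e ⟨i, hi⟩ := by rw [he]; simp
    constructor
    · intro hmj
      by_contra hne
      have hej : e ⟨i, hi⟩ ≠ e j := fun h' => hne (by simpa using (congrArg Fin.val (hP.injective h')).symm)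
      have hsub := hP.linear _ (hP.edgeSet_eq ▸ ⟨_, rfl⟩) _ (hP.edgeSet_eq ▸ ⟨_, rfl⟩) hej
      rcases Nat.lt_or_gt_of_ne hne with h1 | h1
      · by_cases h2 : (j : ℕ) + 1 = i
        · refine hmi (hsub ⟨hmem, hmj⟩ ⟨?_, ?_⟩)
          · exact (hpmem i (by omega) _).2 (by simp)
          · exact (hpmem i (by omega) _).2 (by omega)
        · exact Set.disjoint_left.1 (hP.simple j ⟨i, hi⟩ (by simp; omega)) hmj hmem
      · by_cases h2 : (j : ℕ) = i + 1
        · refine hmi' (hsub ⟨hmem, hmj⟩ ⟨?_, ?_⟩)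
          · exact (hpmem (i + 1) (by omega) _).2 (by simp)
          · exact (hpmem (i + 1) (by omega) _).2 (by omega)
        · exact Set.disjoint_left.1 (hP.simple ⟨i, hi⟩ j (by simp; omega)) hmem hmj
    · intro hj
      convert hmem using 2
      exact Fin.ext hj
  have hpm : ∀ i ≤ n + 1, ∀ j < n + 1, p i ≠ m j := by
    intro i hi j hj h'
    have hmj := (hmmem j hj ⟨j, hj⟩).2 rfl
    rw [← h', hpmem i hi] at hmj
    obtain ⟨-, h1, h2⟩ := hm j hj
    rcases hmj with h3 | h3 <;> simp only at h3 <;> subst h3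
    · exact h1 h'.symm
    · exact h2 h'.symm
  have hminj : ∀ i < n + 1, ∀ j < n + 1, m i = m j → i = j := by
    intro i hi j hj h'
    exact (hmmem j hj ⟨i, hi⟩).1 (h' ▸ (hmmem i hi ⟨i, hi⟩).2 rfl)
  have hVP : ∀ i, e i ⊆ V(P) := fun i => by
    rw [hP.vertexSet_eq]; exact Set.subset_iUnion e i
  have hpc : ∀ i ≤ n + 1, p i ≠ c := by
    rintro i hi rfl
    rcases Nat.eq_zero_or_pos i with rfl | h0
    · exact hc (hVP ⟨0, by omega⟩ ((hpmem 0 hi _).2 (by simp)))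
    · exact hc (hVP ⟨i - 1, by omega⟩ ((hpmem i hi _).2 (by simp; omega)))
  have hmc : ∀ i < n + 1, m i ≠ c := by
    rintro i hi rfl
    exact hc (hVP ⟨i, hi⟩ ((hmmem i hi _).2 rfl))
  -- The default `a` matters at index `2 * (n + 2)`, where it closes the sequence; the default `c`
  -- is the middle vertex of the closing edge.
  let v : ℕ → α := fun k => if k % 2 = 0 then (if k / 2 ≤ n + 1 then p (k / 2) else a)
    else if k / 2 < n + 1 then m (k / 2) else c
  have v0 : ∀ i ≤ n + 1, v (2 * i) = p i := fun i hi => by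
    simp [v, hi]
  have v1 : ∀ i < n + 1, v (2 * i + 1) = m i := fun i hi => by
    simp only [v]
    rw [if_neg (by omega), show (2 * i + 1) / 2 = i by omega, if_pos hi]
  have vc : v (2 * (n + 1) + 1) = c := by
    simp only [v]
    rw [if_neg (by omega), if_neg (by omega)]
  have va : v (2 * (n + 2)) = a := by
    simp [v]
  have pa : p 0 = a := (hp 0 (by omega)).2.1 rfl
  have pb : p (n + 1) = b := (hp (n + 1) le_rfl).2.2 rfl
  have hblock : ∀ i (hi : i < n + 1), (block v i : Set α) = e ⟨i, hi⟩ := fun i hi => by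
    rw [coe_block, v0 i (by omega), v1 i hi, show 2 * i + 2 = 2 * (i + 1) by ring,
      v0 (i + 1) (by omega), (hm i hi).1]
  have hclosing : (block v (n + 1) : Set α) = {a, b, c} := by
    rw [coe_block, v0 _ le_rfl, vc, show 2 * (n + 1) + 2 = 2 * (n + 2) by ring, va, pb]
    ext; simp; tauto
  have hedge : ∀ f, f ∈ E(C) ↔ ∃ i < n + 2, (block v i : Set α) = f := by
    intro f
    rw [hE, Set.mem_insert_iff, hP.edgeSet_eq]
    constructor
    · rintro (rfl | ⟨i, rfl⟩)
      · exact ⟨n + 1, by omega, hclosing⟩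
      · exact ⟨i, by omega, hblock i i.2⟩
    · rintro ⟨i, hi, rfl⟩
      by_cases hin : i = n + 1
      · exact Or.inl (by rw [hin, hclosing])
      · exact Or.inr ⟨⟨i, by omega⟩, (hblock i (by omega)).symm⟩
  have hseq : IsCycleSeq v (n + 2) := by
    refine ⟨by omega, by rw [va, ← pa, ← v0 0 (by omega)], fun i hi j hj hij => ?_⟩
    rcases Nat.even_or_odd' i with ⟨i', rfl | rfl⟩ <;> rcases Nat.even_or_odd' j with ⟨j', rfl | rfl⟩
    · rw [v0 i' (by omega), v0 j' (by omega)] at hij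
      rw [hpinj i' (by omega) j' (by omega) hij]
    · rw [v0 i' (by omega)] at hij
      by_cases hjn : j' = n + 1
      · rw [hjn, vc] at hij
        exact absurd hij (hpc i' (by omega))
      · rw [v1 j' (by omega)] at hij
        exact absurd hij (hpm i' (by omega) j' (by omega))
    · rw [v0 j' (by omega)] at hij
      by_cases hjn : i' = n + 1
      · rw [hjn, vc] at hij
        exact absurd hij.symm (hpc j' (by omega))
      · rw [v1 i' (by omega)] at hij
        exact absurd hij.symm (hpm j' (by omega) i' (by omega))
    · by_cases hi' : i' = n + 1 <;> by_cases hj' : j' = n + 1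
      · rw [hi', hj']
      · rw [hi', vc, v1 j' (by omega)] at hij
        exact absurd hij.symm (hmc j' (by omega))
      · rw [hj', vc, v1 i' (by omega)] at hij
        exact absurd hij (hmc i' (by omega))
      · rw [v1 i' (by omega), v1 j' (by omega)] at hij
        rw [hminj i' (by omega) j' (by omega) hij]
  refine ⟨v, hseq, ?_, hedge⟩
  ext w
  rw [hV, Set.mem_insert_iff, hP.vertexSet_eq, Set.mem_iUnion, Finset.mem_coe]
  constructor
  · rintro (rfl | ⟨i, hi⟩)
    · exact mem_cycleVertices.2 ⟨_, by omega, vc⟩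
    · rw [← hblock i i.2] at hi
      exact hseq.block_subset (by omega) hi
  · intro hw
    obtain ⟨k, hk, rfl⟩ := mem_cycleVertices.1 hw
    by_cases hkn : k = 2 * (n + 1) + 1
    · exact Or.inl (by rw [hkn, vc])
    · obtain ⟨i, hi, hin, hki⟩ := hseq.exists_block (n + 1) hk hkn
      exact Or.inr ⟨⟨i, by omega⟩, by rw [← hblock i (by omega)]; exact hki⟩

theorem IsCycleOn.degree_one (h : C.IsCycleOn v l) :
    {w | w ∈ V(C) ∧ C.degree w = 1} = {w | ∃ i < l, v (2 * i + 1) = w} := by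
  have h3 := h.seq.three_le
  ext w
  rw [Set.mem_ofPred_eq, Set.mem_ofPred_eq, h.vertexSet_eq, Finset.mem_coe, mem_cycleVertices]
  constructor
  · rintro ⟨⟨a, ha, rfl⟩, hdeg⟩
    obtain ⟨i, hi, -, hai⟩ := h.seq.exists_block l ha (by omega)
    rcases Nat.even_or_odd' a with ⟨c, rfl | rfl⟩
    · exfalso
      obtain ⟨j, hj, hji, haj⟩ := h.seq.exists_block i ha (by omega)
      obtain ⟨f, hf⟩ := Set.encard_eq_one.1 hdeg
      have h1 : (block v i : Set α) ∈ {e | e ∈ E(C) ∧ v (2 * c) ∈ e} :=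
        ⟨(h.mem_edgeSet _).2 ⟨i, hi, rfl⟩, hai⟩
      have h2 : (block v j : Set α) ∈ {e | e ∈ E(C) ∧ v (2 * c) ∈ e} :=
        ⟨(h.mem_edgeSet _).2 ⟨j, hj, rfl⟩, haj⟩
      rw [hf, Set.mem_singleton_iff] at h1 h2
      exact hji (h.seq.block_inj hj hi (Finset.coe_injective (h2.trans h1.symm)))
    · exact ⟨c, by omega, rfl⟩
  · rintro ⟨i, hi, rfl⟩
    refine ⟨⟨_, by omega, rfl⟩, Set.encard_eq_one.2 ⟨block v i, ?_⟩⟩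
    ext e
    rw [Set.mem_ofPred_eq, Set.mem_singleton_iff, h.mem_edgeSet]
    constructor
    · rintro ⟨⟨j, hj, rfl⟩, hm⟩
      have := (h.seq.mem_block_iff (by omega) hj).1 hm
      rw [show j = i by omega]
    · rintro rfl
      exact ⟨⟨i, hi, rfl⟩, by simp [mem_block]⟩

theorem IsCycleOn.degree_one_three (h : C.IsCycleOn v 3) :
    {w | w ∈ V(C) ∧ C.degree w = 1} = (({v 1, v 3, v 5} : Finset α) : Set α) := by
  rw [h.degree_one]
  ext w
  simp only [Set.mem_ofPred_eq, Finset.coe_insert, Finset.coe_singleton, Set.mem_insert_iff,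
    Set.mem_singleton_iff]
  constructor
  · rintro ⟨i, hi, rfl⟩
    obtain rfl | rfl | rfl : i = 0 ∨ i = 1 ∨ i = 2 := by omega
    all_goals simp
  · rintro (rfl | rfl | rfl)
    exacts [⟨0, by omega, rfl⟩, ⟨1, by omega, rfl⟩, ⟨2, by omega, rfl⟩]

end Hypergraph

namespace Hypergraph

open AvoiderEnforcer

variable {α : Type*} {H K : Hypergraph α}

/-! ### Connectedness through closed sets -/

/-- A set of vertices is closed if it contains every edge that it meets. -/
def IsClosedSet (H : Hypergraph α) (S : Set α) : Prop :=
  ∀ e ∈ E(H), (e ∩ S).Nonempty → e ⊆ S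

theorem IsWalk.snoc {n : ℕ} {e : Fin (n + 1) → Set α} (he : H.IsWalk e) {f : Set α}
    (hf : f ∈ E(H)) (hne : (e (Fin.last n) ∩ f).Nonempty) :
    H.IsWalk (Fin.snoc e f : Fin (n + 2) → Set α) := by
  refine ⟨fun i => ?_, fun i => ?_⟩
  · refine Fin.lastCases ?_ (fun i => ?_) i
    · simpa using hf
    · simpa using he.1 i
  · refine Fin.lastCases ?_ (fun i => ?_) i
    · simpa using hne
    · rw [Fin.snoc_castSucc, Fin.succ_castSucc, Fin.snoc_castSucc]
      exact he.2 i

/-- The vertices reachable from `a` by walks form, together with `a`, a closed set; conversely a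
closed set absorbs every walk that starts in it. -/
theorem isConnected_iff : H.IsConnected ↔
    ∀ S ⊆ V(H), S.Nonempty → H.IsClosedSet S → S = V(H) := by
  constructor
  · rintro h S hS ⟨a, ha⟩ hcl
    refine hS.antisymm fun b hb => ?_
    by_cases hab : a = b
    · exact hab ▸ ha
    obtain ⟨n, e, he, hae, hbe⟩ := h a (hS ha) b hb hab
    have : ∀ i, e i ⊆ S := by
      intro i
      induction i using Fin.induction with
      | zero => exact hcl _ (he.1 0) ⟨a, hae, ha⟩
      | succ i ih =>
        obtain ⟨w, hw, hw'⟩ := he.2 i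
        exact hcl _ (he.1 _) ⟨w, hw', ih hw⟩
    exact this _ hbe
  · intro h a ha b hb hab
    have := h {x | x ∈ V(H) ∧ (x = a ∨ ∃ (n : ℕ) (e : Fin (n + 1) → Set α), H.IsWalk e ∧ a ∈ e 0 ∧
      x ∈ e (Fin.last n))} (fun x hx => hx.1) ⟨a, ha, Or.inl rfl⟩ ?_
    · rw [← this] at hb
      exact hb.2.resolve_left (Ne.symm hab)
    · rintro f hf ⟨x, hxf, -, rfl | ⟨n, e, he, hae, hxe⟩⟩ y hy
      · exact ⟨H.subset_vertexSet_of_mem_edgeSet' hf hy,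
          Or.inr ⟨0, fun _ => f, ⟨fun _ => hf, fun i => i.elim0⟩, hxf, hy⟩⟩
      · refine ⟨H.subset_vertexSet_of_mem_edgeSet' hf hy,
          Or.inr ⟨n + 1, _, he.snoc hf ⟨x, hxe, hxf⟩, ?_, by simpa using hy⟩⟩
        rw [← Fin.castSucc_zero, Fin.snoc_castSucc]
        exact hae

/-- The smallest closed set of vertices containing `v`. -/
def closedHull (H : Hypergraph α) (v : α) : Set α :=
  {w | ∀ S ⊆ V(H), v ∈ S → H.IsClosedSet S → w ∈ S}

variable {v : α}

theorem self_mem_closedHull : v ∈ H.closedHull v := fun _ _ h _ => h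

theorem closedHull_subset_of_closed {S : Set α} (hS : S ⊆ V(H)) (hv : v ∈ S)
    (hcl : H.IsClosedSet S) : H.closedHull v ⊆ S := fun _ hw => hw S hS hv hcl

theorem closedHull_subset (hv : v ∈ V(H)) : H.closedHull v ⊆ V(H) :=
  closedHull_subset_of_closed subset_rfl hv
    fun _ he _ => H.subset_vertexSet_of_mem_edgeSet' he

theorem isClosedSet_closedHull : H.IsClosedSet (H.closedHull v) := by
  rintro e he ⟨w, hwe, hw⟩ x hx S hS hvS hcl
  exact hcl e he ⟨w, hwe, hw S hS hvS hcl⟩ hx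

/-- The subhypergraph formed by the edges contained in a given set of vertices. -/
def restrict (H : Hypergraph α) (S : Set α) : Hypergraph α where
  vertexSet := S
  edgeSet := {e | e ∈ E(H) ∧ e ⊆ S}
  subset_vertexSet_of_mem_edgeSet' _ he := he.2

/-- If `S` missed `v`, its complement in the hull would be a smaller closed set containing `v`. -/
theorem eq_closedHull {S : Set α} (hv : v ∈ V(H)) (hS : S ⊆ H.closedHull v) (hne : S.Nonempty)
    (hcl : (H.restrict (H.closedHull v)).IsClosedSet S) : S = H.closedHull v := by
  have hcl' : H.IsClosedSet S := fun e he hne' =>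
    hcl e ⟨he, isClosedSet_closedHull e he (hne'.mono (Set.inter_subset_inter_right _ hS))⟩ hne'
  have hsub := closedHull_subset hv
  by_cases hvS : v ∈ S
  · exact hS.antisymm (closedHull_subset_of_closed (hS.trans hsub) hvS hcl')
  · exfalso
    obtain ⟨s, hs⟩ := hne
    have : H.closedHull v ⊆ H.closedHull v \ S := by
      refine closedHull_subset_of_closed (Set.sdiff_subset.trans hsub) ⟨self_mem_closedHull, hvS⟩ ?_
      rintro e he ⟨w, hwe, hw, hwS⟩ x hx
      refine ⟨isClosedSet_closedHull e he ⟨w, hwe, hw⟩ hx, fun hxS => hwS ?_⟩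
      exact hcl' e he ⟨x, hx, hxS⟩ hwe
    exact (this (hS hs)).2 hs

theorem isComponent_restrict_closedHull (hv : v ∈ V(H)) :
    (H.restrict (H.closedHull v)).IsComponent H := by
  refine ⟨⟨closedHull_subset hv, fun e he => he.1⟩, ?_, fun K' hK' hconn hsub => ?_⟩
  · rw [isConnected_iff]
    exact fun S hS hne hcl => eq_closedHull hv hS hne hcl
  · have hV : H.closedHull v = V(K') := (isConnected_iff.1 hconn) _ hsub.1
      ⟨v, self_mem_closedHull⟩ fun e he hne => isClosedSet_closedHull e (hK'.2 he) hne
    refine Hypergraph.ext hV.symm (Set.Subset.antisymm (fun e he => ⟨hK'.2 he, ?_⟩) hsub.2)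
    rw [hV]
    exact K'.subset_vertexSet_of_mem_edgeSet' he

theorem IsComponent.exists_eq (hne : V(H).Nonempty) (hK : K.IsComponent H) :
    ∃ v ∈ V(H), K = H.restrict (H.closedHull v) := by
  -- A subhypergraph without vertices is not maximal: adding one vertex of `H` keeps it connected.
  have hVK : V(K).Nonempty := by
    by_contra hempty
    rw [Set.not_nonempty_iff_eq_empty] at hempty
    obtain ⟨v, hv⟩ := hne
    have := hK.2.2 ⟨{v}, E(K), fun e he => (K.subset_vertexSet_of_mem_edgeSet' he).trans
      (by simp [hempty])⟩ ⟨by simpa using hv, hK.1.2⟩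
      (fun a ha b hb hab => absurd ((Set.mem_singleton_iff.1 ha).trans
        (Set.mem_singleton_iff.1 hb).symm) hab)
      ⟨by simp [hempty], subset_rfl⟩
    have h2 := congrArg vertexSet this
    simp only [hempty] at h2
    exact Set.singleton_ne_empty v h2
  obtain ⟨v, hv⟩ := hVK
  have hvH := hK.1.1 hv
  refine ⟨v, hvH, ?_⟩
  have hcomp := isComponent_restrict_closedHull hvH
  have hV : V(K) ⊆ H.closedHull v := by
    have := (isConnected_iff.1 hK.2.1) (V(K) ∩ H.closedHull v) Set.inter_subset_left
      ⟨v, hv, self_mem_closedHull⟩ fun e he hne => Set.subset_inter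
        (K.subset_vertexSet_of_mem_edgeSet' he)
        (isClosedSet_closedHull e (hK.1.2 he)
          (hne.mono (Set.inter_subset_inter_right _ Set.inter_subset_right)))
    exact Set.inter_eq_left.1 this
  exact (hK.2.2 _ hcomp.1 hcomp.2.1 ⟨hV, fun e he => ⟨hK.1.2 he,
    (K.subset_vertexSet_of_mem_edgeSet' he).trans hV⟩⟩).symm

/-! ### The game on finite sets -/

/-- The edges of a hypergraph contained in a given finite set, as finite sets. -/
noncomputable def finsetEdges (H : Hypergraph α) (R : Finset α) : Finset (Finset α) := by
  classical exact {e ∈ R.powerset | (e : Set α) ∈ E(H)}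

theorem mem_finsetEdges {R e : Finset α} : e ∈ H.finsetEdges R ↔ e ⊆ R ∧ (e : Set α) ∈ E(H) := by
  simp [finsetEdges]

section Game

variable [DecidableEq α]

/-- With Avoider playing last, the parity of the free vertices tells whose turn it is; both
recursions then agree move by move. -/
theorem avoiderWinsFrom_iff {V : Finset α} (hV : (V : Set α) = V(H)) (p : Player) (A R : Finset α)
    (B : Set α) (hA : A ⊆ V) (hR : (R : Set α) = V(H) \ (A ∪ B))
    (hp : (p = .avoider ∧ Odd R.card) ∨ (p = .enforcer ∧ Even R.card)) :
    H.AvoiderWinsFrom p A B ↔ Wins (H.finsetEdges V) A R := by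
  have hover : V(H) ⊆ A ∪ B ↔ R = ∅ := by
    rw [← Set.sdiff_eq_empty, ← hR, Finset.coe_eq_empty]
  induction hn : R.card generalizing p A R B with
  | zero =>
    rw [Finset.card_eq_zero] at hn
    subst hn
    rw [wins_empty]
    constructor
    · intro h e he heA
      cases h with
      | gameOver _ _ _ _ hwin => exact hwin e (mem_finsetEdges.1 he).2 (by exact_mod_cast heA)
      | avoiderMove _ _ x hx _ => rw [← hR] at hx; simp at hx
      | enforcerMove _ _ hne _ => rw [← hR] at hne; simp at hne
    · refine fun h => .gameOver _ _ _ (hover.2 rfl) fun e he heA => ?_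
      have hfin : e.Finite := (A.finite_toSet).subset heA
      lift e to Finset α using hfin
      have heA' : e ⊆ A := by exact_mod_cast heA
      exact h e (mem_finsetEdges.2 ⟨heA'.trans hA, he⟩) heA'
  | succ n ih =>
    have hne : R.Nonempty := Finset.card_pos.1 (by omega)
    have hnover : ¬ V(H) ⊆ A ∪ B := fun h => hne.ne_empty (hover.1 h)
    have hmem : ∀ x, x ∈ V(H) \ (↑A ∪ B) ↔ x ∈ R := fun x => by rw [← hR, Finset.mem_coe]
    have hcard : ∀ x ∈ R, (R.erase x).card = n := fun x hx => by
      rw [Finset.card_erase_of_mem hx, hn, Nat.add_sub_cancel]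
    rcases hp with ⟨rfl, hp⟩ | ⟨rfl, hp⟩
    · rw [wins_of_odd hp]
      have hstep : ∀ x ∈ R, (H.AvoiderWinsFrom .enforcer (insert x (A : Set α)) B ↔
          Wins (H.finsetEdges V) (insert x A) (R.erase x)) := by
        intro x hx
        have hxV : x ∈ V := by
          have := ((hmem x).2 hx).1
          rwa [← hV] at this
        have hR' : ((R.erase x : Finset α) : Set α) = V(H) \ (((insert x A : Finset α) : Set α) ∪ B) := by
          rw [Finset.coe_erase, hR, Finset.coe_insert]
          ext w; simp only [Set.mem_sdiff, Set.mem_union, Set.mem_singleton_iff, Set.mem_insert_iff]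
          tauto
        have := ih .enforcer (insert x A) (R.erase x) B (Finset.insert_subset hxV hA) hR'
          (Or.inr ⟨rfl, even_card_erase hp hx⟩)
          (by rw [← Set.sdiff_eq_empty, ← hR', Finset.coe_eq_empty]) (hcard x hx)
        rwa [Finset.coe_insert] at this
      constructor
      · intro h
        cases h with
        | gameOver _ _ _ hov _ => exact absurd hov hnover
        | avoiderMove _ _ x hx h => exact ⟨x, (hmem x).1 hx, (hstep x ((hmem x).1 hx)).1 h⟩
      · rintro ⟨x, hx, h⟩
        exact .avoiderMove _ _ x ((hmem x).2 hx) ((hstep x hx).2 h)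
    · rw [wins_of_even hp hne]
      have hstep : ∀ y ∈ R, (H.AvoiderWinsFrom .avoider A (insert y B) ↔
          Wins (H.finsetEdges V) A (R.erase y)) := by
        intro y hy
        have hR' : ((R.erase y : Finset α) : Set α) = V(H) \ ((A : Set α) ∪ insert y B) := by
          rw [Finset.coe_erase, hR]
          ext w; simp only [Set.mem_sdiff, Set.mem_union, Set.mem_singleton_iff, Set.mem_insert_iff]
          tauto
        exact ih .avoider A (R.erase y) (insert y B) hA hR'
          (Or.inl ⟨rfl, odd_card_erase hp hy⟩)
          (by rw [← Set.sdiff_eq_empty, ← hR', Finset.coe_eq_empty]) (hcard y hy)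
      constructor
      · intro h
        cases h with
        | gameOver _ _ _ hov _ => exact absurd hov hnover
        | enforcerMove _ _ _ h => exact fun y hy => (hstep y hy).1 (h y ((hmem y).2 hy))
      · intro h
        exact .enforcerMove _ _ (hne.imp fun y hy => (hmem y).2 hy) fun y hy =>
          (hstep y ((hmem y).1 hy)).2 (h y ((hmem y).1 hy))

theorem avoiderWinsAsLast_iff {V : Finset α} (hV : (V : Set α) = V(H)) :
    H.AvoiderWinsAsLast ↔ Wins (H.finsetEdges V) ∅ V := by
  have hc : V(H).ncard = V.card := by rw [← hV, Set.ncard_coe_finset]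
  have key := fun p hp => avoiderWinsFrom_iff hV p ∅ V ∅ (Finset.empty_subset _) (by simp [hV]) hp
  rw [AvoiderWinsAsLast, hc, AvoiderWinsAsFirst, AvoiderWinsAsSecond]
  simp only [Finset.coe_empty] at key
  rcases Nat.even_or_odd V.card with hp | hp
  · rw [← key .enforcer (Or.inr ⟨rfl, hp⟩)]
    simp [hp, Nat.not_odd_iff_even.2 hp]
  · rw [← key .avoider (Or.inl ⟨rfl, hp⟩)]
    simp [hp, Nat.not_even_iff_odd.2 hp]

end Game

end Hypergraph

/-! ### From finite families back to components. -/

namespace Hypergraph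

open AvoiderEnforcer

variable {α : Type*} {H : Hypergraph α} {R : Finset α} {v : α}

theorem mem_edgeSet_restrict (hR : (R : Set α) = H.closedHull v) {e : Set α} :
    e ∈ E(H.restrict (H.closedHull v)) ↔ ∃ f ∈ H.finsetEdges R, (f : Set α) = e := by
  constructor
  · rintro ⟨he, hsub⟩
    rw [← hR] at hsub
    lift e to Finset α using R.finite_toSet.subset hsub
    exact ⟨e, mem_finsetEdges.2 ⟨by exact_mod_cast hsub, he⟩, rfl⟩
  · rintro ⟨f, hf, rfl⟩
    rw [mem_finsetEdges] at hf
    exact ⟨hf.2, by rw [← hR]; exact_mod_cast hf.1⟩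

theorem mem_finsetEdges_iff (hR : (R : Set α) = H.closedHull v) {f : Finset α} :
    f ∈ H.finsetEdges R ↔ (f : Set α) ∈ E(H.restrict (H.closedHull v)) := by
  rw [mem_edgeSet_restrict hR]
  exact ⟨fun h => ⟨f, h, rfl⟩, fun ⟨g, hg, hgf⟩ => Finset.coe_injective hgf ▸ hg⟩

theorem card_le_three (hrank : H.HasRank 3) : ∀ e ∈ H.finsetEdges R, e.card ≤ 3 := by
  intro e he
  have := hrank _ (mem_finsetEdges.1 he).2
  rw [Set.encard_coe_eq_coe_finsetCard] at this
  exact_mod_cast this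

variable [DecidableEq α]

theorem linear_finsetEdges (hlin : H.IsLinear) : Linear (H.finsetEdges R) := by
  intro e he f hf hne
  have := hlin _ (mem_finsetEdges.1 he).2 _ (mem_finsetEdges.1 hf).2
    (fun h => hne (Finset.coe_injective h))
  rw [Finset.card_le_one]
  intro a ha b hb
  exact this (by simpa using ha) (by simpa using hb)

theorem connects_finsetEdges (hv : v ∈ V(H)) (hR : (R : Set α) = H.closedHull v) :
    Connects (H.finsetEdges R) R := by
  intro S hS hne hcl
  rw [← Finset.coe_inj, hR]
  refine eq_closedHull hv (by rw [← hR]; exact_mod_cast hS) (by exact_mod_cast hne) ?_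
  intro e he hne'
  obtain ⟨f, hf, rfl⟩ := (mem_edgeSet_restrict hR).1 he
  exact_mod_cast hcl f hf (by exact_mod_cast hne')

/-- Edges of `H` meeting the hull lie inside it, so a vertex private to an edge there has degree at
most 1 in `H`; two of them make a 3-edge a leaf-edge. -/
theorem reduced_finsetEdges (hred : H.IsReduced) (hR : (R : Set α) = H.closedHull v) :
    Reduced (H.finsetEdges R) := by
  intro g hg hg3 u hu w hw hu' hw'
  by_contra huw
  have hgR := (mem_finsetEdges.1 hg).1
  have hdeg : ∀ x ∈ g, (∀ f ∈ H.finsetEdges R, x ∈ f → f = g) → ¬ 1 < H.degree x := by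
    intro x hx hpriv
    rw [not_lt, degree, Set.encard_le_one_iff]
    have key : ∀ e, e ∈ E(H) → x ∈ e → e = g := by
      intro e he hxe
      have hxR : x ∈ H.closedHull v := hR ▸ (Finset.mem_coe.2 (hgR hx))
      obtain ⟨f, hf, rfl⟩ := (mem_edgeSet_restrict hR).1
        ⟨he, isClosedSet_closedHull e he ⟨x, hxe, hxR⟩⟩
      rw [hpriv f hf hxe]
    rintro e f ⟨he, hxe⟩ ⟨hf, hxf⟩
    rw [key e he hxe, key f hf hxf]
  refine hred g ⟨(mem_finsetEdges.1 hg).2, ?_⟩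
    (by rw [Set.encard_coe_eq_coe_finsetCard, hg3]; rfl)
  rintro x ⟨hx, hxd⟩ y ⟨hy, hyd⟩
  have hc : ((g.erase u).erase w).card ≤ 1 := by
    rw [Finset.card_erase_of_mem (by simp [hw, Ne.symm huw]), Finset.card_erase_of_mem hu, hg3]
  have hmem : ∀ z ∈ (g : Set α), 1 < H.degree z → z ∈ (g.erase u).erase w := by
    intro z hz hzd
    refine Finset.mem_erase.2 ⟨?_, Finset.mem_erase.2 ⟨?_, hz⟩⟩
    · rintro rfl; exact hdeg _ hw hw' hzd
    · rintro rfl; exact hdeg _ hu hu' hzd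
  exact Finset.card_le_one.1 hc x (hmem x hx hxd) y (hmem y hy hyd)

theorem component_of_wins (hrank : H.HasRank 3) (hlin : H.IsLinear) (hred : H.IsReduced)
    (hv : v ∈ V(H)) (hR : (R : Set α) = H.closedHull v) (hw : Wins (H.finsetEdges R) ∅ R) :
    (H.restrict (H.closedHull v)).IsCycle ∨ (H.restrict (H.closedHull v)).IsPrism ∨
      (H.restrict (H.closedHull v)).IsIsolatedTwoEdge ∨
        (H.restrict (H.closedHull v)).IsIsolatedVertex := by
  have hconn := connects_finsetEdges hv hR
  have hvR : v ∈ R := by rw [← Finset.mem_coe, hR]; exact self_mem_closedHull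
  have hedge := fun e => mem_edgeSet_restrict (e := e) hR
  have hvert : V(H.restrict (H.closedHull v)) = R := hR.symm
  rcases structure_of_wins (linear_finsetEdges hlin) (card_le_three hrank)
    (reduced_finsetEdges hred hR) (fun e he => (mem_finsetEdges.1 he).1) hw hconn with
    h0 | ⟨e, he, hRe, hE⟩ | ⟨u, l, hu, hRu, hE | ⟨rfl, hE⟩⟩
  · refine Or.inr (Or.inr (Or.inr ⟨v, ?_, ?_⟩))
    -- Without edges `{v}` is closed, so connectedness leaves no other vertex.
    · rw [hvert, ← hconn {v} (by simpa using hvR) (by simp) (by simp [h0]), Finset.coe_singleton]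
    · ext e
      simp [hedge, h0]
  · obtain ⟨a, b, hab, rfl⟩ := Finset.card_eq_two.1 he
    refine Or.inr (Or.inr (Or.inl ⟨a, b, hab, by rw [hvert, hRe, Finset.coe_pair], ?_⟩))
    ext f
    rw [hedge, hE, Set.mem_singleton_iff]
    simp [eq_comm]
  · refine Or.inl ⟨l, IsCycleOn.isCycleOfLength (v := u) ⟨hu, by rw [hvert, hRu], fun f => ?_⟩⟩
    rw [hedge, hE]
    simp [mem_cycleEdges]
  · let C : Hypergraph α :=
      { vertexSet := cycleVertices u 3
        edgeSet := {e | ∃ i < 3, (block u i : Set α) = e}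
        subset_vertexSet_of_mem_edgeSet' := by
          rintro e ⟨i, hi, rfl⟩
          exact_mod_cast hu.block_subset hi }
    have hC : C.IsCycleOn u 3 := ⟨hu, rfl, fun e => Iff.rfl⟩
    refine Or.inr (Or.inl ⟨C, hC.isCycleOfLength, by rw [hvert, hRu], ?_⟩)
    rw [hC.degree_one_three]
    ext f
    rw [hedge, hE, Set.mem_insert_iff, hC.mem_edgeSet]
    constructor
    · rintro ⟨g, hg, rfl⟩
      rcases Finset.mem_insert.1 hg with rfl | hg
      · exact Or.inl rfl
      · obtain ⟨i, hi, rfl⟩ := mem_cycleEdges.1 hg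
        exact Or.inr ⟨i, hi, rfl⟩
    · rintro (rfl | ⟨i, hi, rfl⟩)
      · exact ⟨_, Finset.mem_insert_self _ _, rfl⟩
      · exact ⟨_, Finset.mem_insert_of_mem (mem_cycleEdges.2 ⟨i, hi, rfl⟩), rfl⟩

theorem wins_component (hlin : H.IsLinear) (hR : (R : Set α) = H.closedHull v)
    (h : (H.restrict (H.closedHull v)).IsCycle ∨ (H.restrict (H.closedHull v)).IsPrism ∨
      (H.restrict (H.closedHull v)).IsIsolatedTwoEdge ∨
        (H.restrict (H.closedHull v)).IsIsolatedVertex) : Wins (H.finsetEdges R) ∅ R := by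
  have hedge := fun f => mem_finsetEdges_iff (f := f) hR
  have hvert : V(H.restrict (H.closedHull v)) = R := hR.symm
  have hlin' : Linear (H.finsetEdges R) := linear_finsetEdges hlin
  have hblock : ∀ (u : ℕ → α) (l : ℕ) (f : Finset α),
      (∃ i < l, (block u i : Set α) = f) ↔ f ∈ cycleEdges u l := fun u l f => by
    rw [mem_cycleEdges]; simp
  rcases h with ⟨l, hl⟩ | ⟨C, hC, hV, hE⟩ | ⟨a, b, hab, -, hE⟩ | ⟨a, -, hE⟩
  · obtain ⟨u, hu⟩ := hl.exists_isCycleOn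
    have hRu : R = cycleVertices u l := by
      rw [← Finset.coe_inj, ← hvert, hu.vertexSet_eq]
    have hEu : H.finsetEdges R = cycleEdges u l := by
      ext f
      rw [hedge, hu.mem_edgeSet, hblock]
    rw [hEu, hRu]
    exact hu.seq.wins
  · obtain ⟨u, hu⟩ := hC.exists_isCycleOn
    have hRu : R = cycleVertices u 3 := by
      rw [← Finset.coe_inj, ← hvert, hV, hu.vertexSet_eq]
    have hEu : H.finsetEdges R = insert {u 1, u 3, u 5} (cycleEdges u 3) := by
      ext f
      rw [hedge, hE, hu.degree_one_three, Set.mem_insert_iff, hu.mem_edgeSet, hblock,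
        Finset.mem_insert, Finset.coe_inj]
    rw [hEu] at hlin' ⊢
    rw [hRu]
    exact hu.seq.wins_prism hlin'
  · have hEu : H.finsetEdges R = {{a, b}} := by
      ext f
      rw [hedge, hE, Set.mem_singleton_iff, Finset.mem_singleton, ← Finset.coe_pair, Finset.coe_inj]
    rw [hEu]
    exact wins_singleton_edge (Finset.card_pair hab) R
  · have hEu : H.finsetEdges R = ∅ := by
      ext f
      rw [hedge, hE]
      simp
    rw [hEu]
    exact wins_empty_edges _ _

/-- If Avoider wins as last player on all components then she does so on the whole hypergraph. -/
theorem wins_of_wins_components {V : Finset α} (hV : (V : Set α) = V(H)) (hne : V.Nonempty)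
    (h : ∀ v ∈ V(H), ∀ R : Finset α, (R : Set α) = H.closedHull v → Wins (H.finsetEdges R) ∅ R) :
    Wins (H.finsetEdges V) ∅ V := by
  have hull : ∀ v ∈ V, ∃ R ⊆ V, (R : Set α) = H.closedHull v := by
    intro v hv
    have hsub := closedHull_subset (H := H) (v := v) (by rw [← hV]; exact hv)
    rw [← hV] at hsub
    obtain ⟨R, hR⟩ := (V.finite_toSet.subset hsub).exists_finset_coe
    exact ⟨R, by rw [← hR] at hsub; exact_mod_cast hsub, hR⟩
  have main : ∀ S ⊆ V, H.IsClosedSet S → Wins (H.finsetEdges V) ∅ S := by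
    intro S
    induction S using Finset.strongInduction with
    | _ S ih =>
      intro hSV hcl
      rcases S.eq_empty_or_nonempty with rfl | ⟨v, hv⟩
      -- Only an empty edge could be lost here; it would lie in every component and defeat Avoider
      -- there.
      · rw [wins_empty]
        intro e he hemp
        rw [Finset.subset_empty] at hemp
        subst hemp
        obtain ⟨v, hv⟩ := hne
        obtain ⟨R, -, hR⟩ := hull v hv
        have := (h v (by rw [← hV]; exact hv) R hR).two_le_card (e := ∅)
          (mem_finsetEdges.2 ⟨Finset.empty_subset _, (mem_finsetEdges.1 he).2⟩)
          (Finset.empty_subset _)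
        simp at this
      · obtain ⟨R, hRV, hR⟩ := hull v (hSV hv)
        have hvH : v ∈ V(H) := by rw [← hV]; exact hSV hv
        have hRS : R ⊆ S := by
          have := closedHull_subset_of_closed (by rw [← hV]; exact_mod_cast hSV)
            (Finset.mem_coe.2 hv) hcl
          rw [← hR] at this
          exact_mod_cast this
        have hvR : v ∈ R := by rw [← Finset.mem_coe, hR]; exact self_mem_closedHull
        have hclR : H.IsClosedSet R := hR ▸ isClosedSet_closedHull
        have h₁ : Wins (H.finsetEdges V) ∅ R := (h v hvH R hR).mono subset_rfl fun f hf hfR =>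
          ⟨f, mem_finsetEdges.2 ⟨by simpa using hfR, (mem_finsetEdges.1 hf).2⟩, subset_rfl⟩
        have h₂ : Wins (H.finsetEdges V) ∅ (S \ R) := by
          refine ih _ (Finset.sdiff_ssubset hRS ⟨v, hvR⟩) (Finset.sdiff_subset.trans hSV) ?_
          rintro e he ⟨w, hwe, hw⟩ x hx
          rw [Finset.coe_sdiff] at hw ⊢
          exact ⟨hcl e he ⟨w, hwe, hw.1⟩ hx, fun hxR => hw.2 (hclR e he ⟨x, hx, hxR⟩ hwe)⟩
        have := h₁.union (R : Set α) h₂ (by simp) (by simp) fun e he => by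
          by_cases hmeet : ((e : Set α) ∩ R).Nonempty
          · exact Or.inl fun z hz => hclR e (mem_finsetEdges.1 he).2 hmeet hz
          · exact Or.inr fun z hz hzR => hmeet ⟨z, hz, hzR⟩
        rwa [Finset.empty_union, Finset.union_sdiff_of_subset hRS] at this
  refine main V subset_rfl fun e he _ => ?_
  rw [hV]
  exact H.subset_vertexSet_of_mem_edgeSet' he

end Hypergraph

theorem theorem4 {α : Type*} (H : Hypergraph α)
    (hfin : H.vertexSet.Finite) (hne : H.vertexSet.Nonempty)
    (hrank : H.HasRank 3) (hlin : H.IsLinear) (hred : H.IsReduced) :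
    H.AvoiderWinsAsLast ↔
      ∀ K : Hypergraph α, K.IsComponent H →
        K.IsCycle ∨ K.IsPrism ∨ K.IsIsolatedTwoEdge ∨ K.IsIsolatedVertex := by
  classical
  obtain ⟨V, hV⟩ := hfin.exists_finset_coe
  rw [Hypergraph.avoiderWinsAsLast_iff hV]
  constructor
  · intro hw K hK
    obtain ⟨v, hv, rfl⟩ := hK.exists_eq hne
    have hsub := Hypergraph.closedHull_subset hv
    obtain ⟨R, hR⟩ := (hfin.subset hsub).exists_finset_coe
    have hRV : R ⊆ V := by
      rw [← hR, ← hV] at hsub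
      exact_mod_cast hsub
    refine Hypergraph.component_of_wins hrank hlin hred hv hR ((hw.subset hRV).edges fun e he => ?_)
    rw [Hypergraph.mem_finsetEdges] at he ⊢
    exact ⟨he.1.trans hRV, he.2⟩
  · intro h
    refine Hypergraph.wins_of_wins_components hV (by rw [← hV] at hne; exact_mod_cast hne)
      fun v hv R hR => ?_
    exact Hypergraph.wins_component hlin hR
      (h _ (Hypergraph.isComponent_restrict_closedHull hv))
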